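/- Let $\{\xi_i\}_{i\ge 0}$ be a centered stationary Gaussian sequence with $\mathbb{E}\,\xi_i^2=1$ whose correlation function $\rho(i):=\mathbb{E}[\xi_0\xi_i]$ is non-negative and summable, i.e. $\rho(i)\ge 0$ for all $i\ge 0$ and $\sum_{i=0}^\infty\rho(i)<\infty$. Let $\{\sigma(i)\}_{i\ge 1}$ be a sequence of positive real numbers, and put $s(n):=\big(\sum_{i=1}^n\sigma(i)^2\big)^{1/2}$. Assume that 1. $\lim_{n\to\infty}s(n)=\infty$; 2. $\lim_{n\to\infty}\sigma(n+\ell)/\sigma(n)=1$ for every integer $\ell\ge 1$; 3. there is a constant $C<\infty$ such that $\frac{\sigma(m)}{s(m)}\le C\,\frac{\sigma(n)}{s(n)}$ for all integers $m\ge n\ge 1$. Let $S_\ell:=\sum_{i=1}^\ell\sigma(i)\xi_i$ and $q_n:=\mathbb{P}\big(\max_{1\le\ell\le n}S_\ell<0\big)$. Then $$\lim_{n\to\infty}\frac{\log q_n}{\log s(n)}=-1.$$ -/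

import Mathlib

open MeasureTheory ProbabilityTheory Filter Topology

namespace WeightedPersistence

/-- A real sequence of random variables is stationary if the law of the whole sequence is
invariant under every time shift. -/
def IsStationary {Ω : Type*} [MeasurableSpace Ω] (ξ : ℕ → Ω → ℝ) (P : Measure Ω) : Prop :=
  ∀ k : ℕ, IdentDistrib (fun ω (i : ℕ) => ξ (i + k) ω) (fun ω (i : ℕ) => ξ i ω) P P

/-- The correlation function `ρ(i) = E[ξ₀ ξᵢ]`. -/
noncomputable def corr {Ω : Type*} [MeasurableSpace Ω] (ξ : ℕ → Ω → ℝ) (P : Measure Ω)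
    (i : ℕ) : ℝ :=
  ∫ ω, ξ 0 ω * ξ i ω ∂P

/-- The weighted partial sum `S_ℓ = ∑_{i=1}^ℓ σ(i) ξᵢ`. -/
noncomputable def partialSum {Ω : Type*} (σ : ℕ → ℝ) (ξ : ℕ → Ω → ℝ) (l : ℕ) (ω : Ω) : ℝ :=
  ∑ i ∈ Finset.Icc 1 l, σ i * ξ i ω

/-- `s(n)`, with `s(n)² = ∑_{i=1}^n σ(i)²` and `s(n) ≥ 0`. -/
noncomputable def scale (σ : ℕ → ℝ) (n : ℕ) : ℝ :=
  Real.sqrt (∑ i ∈ Finset.Icc 1 n, σ i ^ 2)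

/-- The persistence probability `q_n = P(max_{1 ≤ ℓ ≤ n} S_ℓ < 0)`. -/
noncomputable def persistenceProb {Ω : Type*} [MeasurableSpace Ω] (σ : ℕ → ℝ) (ξ : ℕ → Ω → ℝ)
    (P : Measure Ω) (n : ℕ) : ℝ :=
  P.real {ω | ∀ l ∈ Finset.Icc 1 n, partialSum σ ξ l ω < 0}

end WeightedPersistence

namespace WeightedPersistence
open scoped Matrix RealInnerProductSpace ENNReal

/-! ### Centred Gaussian vectors and orthant probabilities. -/

section GaussianLaw

variable {ι : Type*} [Fintype ι]

/-! Only logarithmic precision is needed, so both bounds compare the sums with a Gaussian walk with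
independent increments, whose survival until its standard deviation is `τ` costs about `1 / τ`.

Lower bound. Nonnegative correlations make `E[S_k S_l]` at least `Var S_(min k l)`, the covariance
of the independent walk with the same variances. Slepian's inequality (`orthantProb_mono`) then
gives `stdSeq_walkNeg_le_persistenceProb`. `le_walkNeg` bounds the survival of that walk from below
by a heat flow with odd initial data, and summability of `ρ` keeps `Var S_n` below a multiple of
`s(n)²`.

Upper bound. Keep only times along which `s²` grows geometrically with a ratio close to 1
(`exists_sample_points`). Weights at bounded distance are asymptotically equal, so each block
variance is nearly `totalCorr ρ` times the squared weight of the block, while Schur's test bounds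
the whole block covariance matrix by that same diagonal. Since the entries are nonnegative, the
normalised matrix is squeezed between `1 - 2e` and `1`, and making the blocks independent costs a
factor `(1 - 2e)^(-1/2)` per block (`multivariateGaussian_apply_le`). For the independent walk, `-w
+ b τ` is superharmonic up to a factor `1 + δ η` per step (`walkNeg_real_le`). There are `O(log s(n)
/ η)` blocks, so with `e` of order `δ η` the total loss is `s(n)^(O(δ))`, and `δ` is arbitrary. -/

lemma measurableSet_orthant (b : ι → ℝ) :
    MeasurableSet {x : EuclideanSpace ℝ ι | ∀ i, x i < b i} := by
  rw [Set.ofPred_forall]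
  exact MeasurableSet.iInter fun i => measurableSet_lt (by fun_prop) measurable_const

lemma posSemidef_of_forall {S : Matrix ι ι ℝ} (hsymm : ∀ i j, S i j = S j i)
    (h : ∀ x : ι → ℝ, 0 ≤ ∑ i, ∑ j, x i * x j * S i j) : S.PosSemidef := by
  refine Matrix.PosSemidef.of_dotProduct_mulVec_nonneg ?_ fun x => ?_
  · ext i j; simp [Matrix.conjTranspose_apply, hsymm i j]
  · have := h x
    simp only [dotProduct, Matrix.mulVec, star_trivial, Finset.mul_sum]
    refine this.trans_eq (Finset.sum_congr rfl fun i _ => Finset.sum_congr rfl fun j _ => ?_)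
    ring

lemma posSemidef_of_integral_mul {Ω : Type*} [MeasurableSpace Ω] {P : Measure Ω}
    {X : Ω → ι → ℝ} (hX : HasGaussianLaw X P) {S : Matrix ι ι ℝ}
    (hS : ∀ i j, ∫ ω, X ω i * X ω j ∂P = S i j) : S.PosSemidef := by
  have hL : ∀ i, MemLp (fun ω => X ω i) 2 P := fun i => (hX.eval i).memLp_two
  refine posSemidef_of_forall (fun i j => ?_) fun x => ?_
  · rw [← hS, ← hS]; simp_rw [mul_comm]
  · have : ∑ i, ∑ j, x i * x j * S i j = ∫ ω, (∑ i, x i * X ω i) ^ 2 ∂P := by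
      simp_rw [sq, Finset.sum_mul_sum]
      rw [integral_finsetSum]
      · refine Finset.sum_congr rfl fun i _ => ?_
        rw [integral_finsetSum]
        · refine Finset.sum_congr rfl fun j _ => ?_
          rw [← hS, ← integral_const_mul]
          congr 1; ext ω; ring
        · intro j _
          have := ((hL i).integrable_mul (hL j)).const_mul (x i * x j)
          exact this.congr (ae_of_all _ fun ω => by simp; ring)
      · intro i _
        refine integrable_finsetSum _ fun j _ => ?_
        have := ((hL i).integrable_mul (hL j)).const_mul (x i * x j)
        exact this.congr (ae_of_all _ fun ω => by simp; ring)
    rw [this]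
    exact integral_nonneg fun ω => sq_nonneg _

variable [DecidableEq ι]

/-- The probability that a centred Gaussian vector with covariance matrix `S` lies strictly
below `b` in every coordinate. -/
noncomputable def orthantProb (b : ι → ℝ) (S : Matrix ι ι ℝ) : ℝ≥0∞ :=
  multivariateGaussian 0 S {x | ∀ i, x i < b i}

/-- A centred Gaussian vector is distributed according to its covariance matrix. -/
lemma map_eq_multivariateGaussian {Ω : Type*} [MeasurableSpace Ω] {P : Measure Ω}
    {X : Ω → ι → ℝ} (hX : HasGaussianLaw X P) (hmean : ∀ i, ∫ ω, X ω i ∂P = 0)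
    {S : Matrix ι ι ℝ} (hS : ∀ i j, ∫ ω, X ω i * X ω j ∂P = S i j) :
    P.map (fun ω => WithLp.toLp 2 (X ω)) = multivariateGaussian 0 S := by
  have hP := hX.isProbabilityMeasure
  have hpsd := posSemidef_of_integral_mul hX hS
  have hG : HasGaussianLaw (fun ω => WithLp.toLp 2 (X ω)) P := hX.toLp_pi 2
  have hGm := hG.isGaussian_map
  have hL : ∀ i, MemLp (fun ω => X ω i) 2 P := fun i => (hX.eval i).memLp_two
  have hae := hG.aemeasurable
  apply IsGaussian.ext
  · simp only [id_eq, integral_id_multivariateGaussian]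
    rw [integral_map hae (by fun_prop)]
    ext i
    have h1 : ∫ ω, X ω i ∂P = (∫ ω, WithLp.toLp 2 (X ω) ∂P).ofLp i :=
      (EuclideanSpace.proj (𝕜 := ℝ) i).integral_comp_comm hG.integrable
    rw [← h1]
    simpa using hmean i
  · rw [← ContinuousLinearMap.toBilinForm_inj]
    refine LinearMap.BilinForm.ext_basis (EuclideanSpace.basisFun ι ℝ).toBasis fun i j ↦ ?_
    rw [ContinuousLinearMap.toBilinForm_apply, ContinuousLinearMap.toBilinForm_apply,
      covarianceBilin_apply_eq_cov IsGaussian.memLp_two_id,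
      covarianceBilin_multivariateGaussian hpsd,
      covariance_map (by fun_prop) (by fun_prop) hae]
    have (i : ι) : (fun u ↦ ⟪(EuclideanSpace.basisFun ι ℝ).toBasis i, u⟫) ∘
          (fun ω => WithLp.toLp 2 (X ω)) = fun ω ↦ X ω i := by ext; simp [PiLp.inner_apply]
    rw [this, this, covariance_eq_sub (hL i) (hL j)]
    simp [hmean, ← hS i j]

/-- Adding an independent Gaussian multiple of `v` adds `v vᵀ` to the covariance matrix. -/
lemma multivariateGaussian_add_vecMulVec {S : Matrix ι ι ℝ} (hS : S.PosSemidef) (v : ι → ℝ) :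
    multivariateGaussian 0 (S + Matrix.vecMulVec v v) =
      ((multivariateGaussian 0 S).prod (gaussianReal 0 1)).map
        (fun p => p.1 + p.2 • WithLp.toLp 2 v) := by
  have hv : (Matrix.vecMulVec v v).PosSemidef := by
    simpa using Matrix.posSemidef_vecMulVec_self_star v
  have hmeas : Measurable (fun p : EuclideanSpace ℝ ι × ℝ => p.1 + p.2 • WithLp.toLp 2 v) := by
    fun_prop
  have : IsProbabilityMeasure (((multivariateGaussian 0 S).prod (gaussianReal 0 1)).map
        (fun p => p.1 + p.2 • WithLp.toLp 2 v)) := Measure.isProbabilityMeasure_map hmeas.aemeasurable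
  apply Measure.ext_of_charFun
  ext t
  rw [charFun_multivariateGaussian (hS.add hv), charFun_apply,
    integral_map hmeas.aemeasurable (by fun_prop)]
  have : ∀ p : EuclideanSpace ℝ ι × ℝ, Complex.exp (⟪p.1 + p.2 • WithLp.toLp 2 v, t⟫ * Complex.I) =
      Complex.exp (⟪p.1, t⟫ * Complex.I) *
        Complex.exp (⟪p.2, ⟪WithLp.toLp 2 v, t⟫⟫ * Complex.I) := by
    intro p
    rw [← Complex.exp_add, inner_add_left, real_inner_smul_left]
    congr 1
    simp
    ring
  simp_rw [this]
  rw [integral_prod_mul (fun x : EuclideanSpace ℝ ι => Complex.exp (⟪x, t⟫ * Complex.I))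
    (fun h : ℝ => Complex.exp (⟪h, ⟪WithLp.toLp 2 v, t⟫⟫ * Complex.I)), ← charFun_apply,
    ← charFun_apply, charFun_multivariateGaussian hS, charFun_gaussianReal, ← Complex.exp_add]
  congr 1
  have h1 : t.ofLp ⬝ᵥ Matrix.vecMulVec v v *ᵥ t.ofLp = ⟪WithLp.toLp 2 v, t⟫ ^ 2 := by
    rw [Matrix.vecMulVec_mulVec]
    simp [PiLp.inner_apply, dotProduct, sq, Finset.sum_mul, Finset.mul_sum]
    refine Finset.sum_congr rfl fun i _ => Finset.sum_congr rfl fun j _ => ?_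
    ring
  rw [Matrix.add_mulVec, dotProduct_add, h1]
  simp
  ring

/-- Conditioning on everything but one scalar noise reduces comparisons of orthant probabilities to
one-dimensional ones. -/
lemma orthantProb_add_vecMulVec {S : Matrix ι ι ℝ} (hS : S.PosSemidef) (v b : ι → ℝ) :
    orthantProb b (S + Matrix.vecMulVec v v) =
      ∫⁻ u, gaussianReal 0 1 {h | ∀ i, u i + h * v i < b i} ∂multivariateGaussian 0 S := by
  rw [orthantProb, multivariateGaussian_add_vecMulVec hS, Measure.map_apply (by fun_prop)
    (measurableSet_orthant b), Measure.prod_apply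
      ((measurableSet_orthant b).preimage (by fun_prop))]
  rfl

end GaussianLaw
end WeightedPersistence

namespace WeightedPersistence
open scoped Matrix RealInnerProductSpace ENNReal

/-! ### Slepian's inequality for nondegenerate covariances, by sharing noise between pairs. -/

section Slepian

variable {ι : Type*} [Fintype ι] [DecidableEq ι]

/-- With the rest frozen at `u`, coordinates `i` and `j` constrain the noise to sets `A` and `B`.
Separate noises give the product of their probabilities, a common noise the probability of `A ∩ B`;
since `A` and `B` are nested, the latter is the minimum and hence at least the product. -/
lemma lintegral_orthant_le (b u : ι → ℝ) {i j : ι} (hij : i ≠ j) (r : ℝ) :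
    ∫⁻ g, gaussianReal 0 1 {h | ∀ k, u k + g * (Pi.single i r : ι → ℝ) k +
        h * (Pi.single j r : ι → ℝ) k < b k} ∂gaussianReal 0 1 ≤
      gaussianReal 0 1 {h | ∀ k, u k + h * (Pi.single i r + Pi.single j r : ι → ℝ) k < b k} := by
  set A : Set ℝ := {h | u i + h * r < b i}
  set B : Set ℝ := {h | u j + h * r < b j}
  have hA : MeasurableSet A := measurableSet_lt (by fun_prop) measurable_const
  -- The other coordinates carry no noise: if one of them fails, the left side vanishes.
  by_cases hk : ∀ k, k ≠ i → k ≠ j → u k < b k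
  · have hAB : A ∩ B ⊆ {h | ∀ k, u k + h * (Pi.single i r + Pi.single j r : ι → ℝ) k < b k} := by
      rintro h ⟨hi, hj⟩ k
      by_cases hki : k = i
      · subst hki; simpa [hij, A] using hi
      by_cases hkj : k = j
      · subst hkj; simpa [hij.symm, B] using hj
      simpa [hki, hkj] using hk k hki hkj
    refine le_trans ?_ (measure_mono hAB)
    calc _ ≤ ∫⁻ g, A.indicator (fun _ => gaussianReal 0 1 B) g ∂gaussianReal 0 1 := by
          refine lintegral_mono fun g => ?_
          by_cases hg : g ∈ A
          · simp only [hg, Set.indicator_of_mem]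
            refine measure_mono fun h hh => ?_
            simpa [hij.symm, B] using hh j
          · refine le_trans (le_of_eq ?_) zero_le
            convert measure_empty (μ := gaussianReal 0 1)
            ext h
            simp only [Set.mem_ofPred_eq, Set.mem_empty_iff_false, iff_false, not_forall]
            exact ⟨i, by simpa [hij, A] using hg⟩
      _ = gaussianReal 0 1 B * gaussianReal 0 1 A := by
          rw [lintegral_indicator hA, setLIntegral_const]
      _ ≤ gaussianReal 0 1 (A ∩ B) := by
          rcases le_total (b i - u i) (b j - u j) with hle | hle
          · have : A ∩ B = A := by
              refine Set.inter_eq_left.2 fun h hh => ?_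
              simp only [A, B, Set.mem_ofPred_eq] at hh ⊢; linarith
            rw [this]; exact mul_le_of_le_one_left' prob_le_one
          · have : A ∩ B = B := by
              refine Set.inter_eq_right.2 fun h hh => ?_
              simp only [A, B, Set.mem_ofPred_eq] at hh ⊢; linarith
            rw [this]; exact mul_le_of_le_one_right' prob_le_one
  · push Not at hk
    obtain ⟨k, hki, hkj, hk⟩ := hk
    refine le_trans (le_of_eq ?_) zero_le
    rw [lintegral_eq_zero_of_ae_eq_zero]
    refine ae_of_all _ fun g => ?_
    have : {h : ℝ | ∀ k, u k + g * (Pi.single i r : ι → ℝ) k +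
        h * (Pi.single j r : ι → ℝ) k < b k} = ∅ := by
      ext h
      simp only [Set.mem_ofPred_eq, Set.mem_empty_iff_false, iff_false, not_forall, not_lt]
      exact ⟨k, by simpa [hki, hkj] using hk⟩
    simp [this]

lemma orthantProb_le_of_independent_noise {U : Matrix ι ι ℝ} (hU : U.PosSemidef) (b : ι → ℝ)
    {i j : ι} (hij : i ≠ j) (r : ℝ) :
    orthantProb b (U + Matrix.vecMulVec (Pi.single i r) (Pi.single i r) +
        Matrix.vecMulVec (Pi.single j r) (Pi.single j r)) ≤
      orthantProb b (U + Matrix.vecMulVec (Pi.single i r + Pi.single j r)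
        (Pi.single i r + Pi.single j r)) := by
  have hv : (Matrix.vecMulVec (Pi.single i r) (Pi.single i r) : Matrix ι ι ℝ).PosSemidef := by
    simpa using Matrix.posSemidef_vecMulVec_self_star (Pi.single i r : ι → ℝ)
  have hmeas : Measurable fun u : EuclideanSpace ℝ ι =>
      gaussianReal 0 1 {h : ℝ | ∀ k, u k + h * (Pi.single j r : ι → ℝ) k < b k} := by
    have : MeasurableSet {p : EuclideanSpace ℝ ι × ℝ |
        ∀ k, p.1 k + p.2 * (Pi.single j r : ι → ℝ) k < b k} := by
      rw [Set.ofPred_forall]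
      exact MeasurableSet.iInter fun i => measurableSet_lt (by fun_prop) measurable_const
    exact measurable_measure_prodMk_left this
  rw [orthantProb_add_vecMulVec (hU.add hv), orthantProb_add_vecMulVec hU,
    multivariateGaussian_add_vecMulVec hU, lintegral_map hmeas (by fun_prop),
    lintegral_prod]
  swap
  · exact (hmeas.comp (g := fun u => _) (by fun_prop : Measurable fun p : EuclideanSpace ℝ ι × ℝ =>
      p.1 + p.2 • WithLp.toLp 2 (Pi.single i r : ι → ℝ))).aemeasurable
  refine lintegral_mono fun u => ?_
  exact lintegral_orthant_le b u.ofLp hij r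

/-- The symmetric matrix whose only nonzero entries are ones at `(i, j)` and `(j, i)`. -/
def pairMatrix (p : ι × ι) : Matrix ι ι ℝ :=
  Matrix.single p.1 p.2 1 + Matrix.single p.2 p.1 1

/-- The part `c • 1` of the covariance is a supply of independent noise. An amount `θ` of it at `i`
and at `j` is merged into a common noise; the second conclusion records the supply that remains for
further pairs. -/
lemma orthantProb_le_add_pairMatrix {S : Matrix ι ι ℝ} {c : ℝ}
    (hS : (S - c • (1 : Matrix ι ι ℝ)).PosSemidef) (b : ι → ℝ) {p : ι × ι} (hp : p.1 ≠ p.2)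
    {θ : ℝ} (hθ : 0 ≤ θ) (hθc : θ ≤ c) :
    orthantProb b S ≤ orthantProb b (S + θ • pairMatrix p) ∧
      (S + θ • pairMatrix p - (c - θ) • (1 : Matrix ι ι ℝ)).PosSemidef := by
  obtain ⟨i, j⟩ := p
  simp only at hp
  have hr := Real.mul_self_sqrt hθ
  set r := √θ
  set D : Matrix ι ι ℝ := Matrix.diagonal fun k => if k = i ∨ k = j then 0 else 1
  have hD : D.PosSemidef := Matrix.PosSemidef.diagonal fun k => by
    simp only [Pi.zero_apply]; split_ifs <;> norm_num
  have hvv : (Matrix.vecMulVec (Pi.single i r + Pi.single j r)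
      (Pi.single i r + Pi.single j r) : Matrix ι ι ℝ).PosSemidef := by
    simpa using Matrix.posSemidef_vecMulVec_self_star (Pi.single i r + Pi.single j r : ι → ℝ)
  -- This is `S` with `θ` removed from the diagonal entries at `i` and `j`, written as a sum of
  -- semidefinite terms.
  set U : Matrix ι ι ℝ := (S - c • 1) + ((c - θ) • 1 + θ • D)
  have hU : U.PosSemidef :=
    hS.add ((Matrix.PosSemidef.one.smul (sub_nonneg.2 hθc)).add (hD.smul hθ))
  have hS' : S = U + Matrix.vecMulVec (Pi.single i r) (Pi.single i r) +
        Matrix.vecMulVec (Pi.single j r) (Pi.single j r) := by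
    ext a d
    simp only [U, D, Matrix.add_apply, Matrix.sub_apply, Matrix.smul_apply, Matrix.one_apply,
      Matrix.vecMulVec_apply, Matrix.diagonal_apply, Pi.single_apply, smul_eq_mul, ← hr]
    clear_value r
    split_ifs <;> simp_all
  have hT : S + θ • pairMatrix (i, j) = U + Matrix.vecMulVec (Pi.single i r + Pi.single j r)
        (Pi.single i r + Pi.single j r) := by
    have hpair : θ • pairMatrix (i, j) = Matrix.vecMulVec (Pi.single i r) (Pi.single j r) +
        Matrix.vecMulVec (Pi.single j r) (Pi.single i r) := by
      have hs : ∀ k : ι, (Pi.single k r : ι → ℝ) = r • Pi.single k 1 := fun k => by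
        rw [← Pi.single_smul, smul_eq_mul, mul_one]
      rw [pairMatrix, Matrix.single_eq_single_vecMulVec_single,
        Matrix.single_eq_single_vecMulVec_single, hs i, hs j, ← hr]
      simp only [Matrix.smul_vecMulVec, Matrix.vecMulVec_smul, smul_smul, smul_add]
    rw [hpair]
    conv_lhs => rw [hS']
    rw [Matrix.add_vecMulVec, Matrix.vecMulVec_add, Matrix.vecMulVec_add]
    abel
  refine ⟨?_, ?_⟩
  · rw [hT]
    conv_lhs => rw [hS']
    exact orthantProb_le_of_independent_noise hU b hp r
  · have : S + θ • pairMatrix (i, j) - (c - θ) • (1 : Matrix ι ι ℝ) =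
        (S - c • 1) + θ • D + Matrix.vecMulVec (Pi.single i r + Pi.single j r)
        (Pi.single i r + Pi.single j r) := by
      rw [hT]; simp only [U]; abel
    rw [this]
    exact (hS.add (hD.smul hθ)).add hvv

lemma orthantProb_le_add_sum_pairMatrix (b : ι → ℝ) (s : Finset (ι × ι))
    (hs : ∀ p ∈ s, p.1 ≠ p.2) {θ : ι × ι → ℝ} (hθ : ∀ p, 0 ≤ θ p) {S : Matrix ι ι ℝ} {c : ℝ}
    (hS : (S - c • (1 : Matrix ι ι ℝ)).PosSemidef) (hc : ∑ p ∈ s, θ p ≤ c) :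
    orthantProb b S ≤ orthantProb b (S + ∑ p ∈ s, θ p • pairMatrix p) := by
  induction s using Finset.induction_on generalizing S c with
  | empty => simp
  | insert p s hps ih =>
    rw [Finset.sum_insert hps] at hc
    have h0 : 0 ≤ ∑ p ∈ s, θ p := Finset.sum_nonneg fun p _ => hθ p
    obtain ⟨h1, h2⟩ := orthantProb_le_add_pairMatrix hS b (hs p (Finset.mem_insert_self _ _))
      (hθ p) (by linarith)
    rw [Finset.sum_insert hps, ← add_assoc]
    exact h1.trans (ih (fun q hq => hs q (Finset.mem_insert_of_mem hq)) h2 (by linarith))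

/-- Ordered pairs list each unordered pair twice, hence the half. -/
lemma sum_offDiag_pairMatrix {Δ : Matrix ι ι ℝ} (hsymm : ∀ i j, Δ i j = Δ j i)
    (hdiag : ∀ i, Δ i i = 0) :
    ∑ p ∈ (Finset.univ : Finset ι).offDiag, (Δ p.1 p.2 / 2) • pairMatrix p = Δ := by
  have h1 : ∑ p ∈ (Finset.univ : Finset ι).offDiag, (Δ p.1 p.2 / 2) • pairMatrix p =
      ∑ p : ι × ι, (Δ p.1 p.2 / 2) • pairMatrix p := by
    refine Finset.sum_subset (Finset.subset_univ _) fun p _ hp => ?_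
    have : p.1 = p.2 := by simpa using hp
    rw [this, hdiag]; simp
  rw [h1]
  have h2 : ∑ p : ι × ι, (Δ p.1 p.2 / 2) • Matrix.single p.1 p.2 (1 : ℝ) = (1 / 2 : ℝ) • Δ := by
    conv_rhs => rw [Matrix.matrix_eq_sum_single Δ]
    rw [Fintype.sum_prod_type, Finset.smul_sum]
    refine Finset.sum_congr rfl fun i _ => ?_
    rw [Finset.smul_sum]
    refine Finset.sum_congr rfl fun j _ => ?_
    simp only [Matrix.smul_single, smul_eq_mul]
    congr 1; ring
  have h3 : ∑ p : ι × ι, (Δ p.1 p.2 / 2) • Matrix.single p.2 p.1 (1 : ℝ) = (1 / 2 : ℝ) • Δ := by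
    rw [← h2, ← Equiv.sum_comp (Equiv.prodComm ι ι)]
    exact Finset.sum_congr rfl fun p _ => by simp [hsymm p.1 p.2]
  simp only [pairMatrix, smul_add, Finset.sum_add_distrib, h2, h3]
  module

/-- Slepian's inequality for uniformly nondegenerate covariance matrices. -/
lemma orthantProb_mono_of_nondegenerate (b : ι → ℝ) {S T : Matrix ι ι ℝ} {c : ℝ} (hc : 0 < c)
    (hS : (S - c • (1 : Matrix ι ι ℝ)).PosSemidef) (hT : (T - c • (1 : Matrix ι ι ℝ)).PosSemidef)
    (hdiag : ∀ i, S i i = T i i) (hle : ∀ i j, S i j ≤ T i j) :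
    orthantProb b S ≤ orthantProb b T := by
  set Δ := T - S
  have hΔ0 : ∀ i j, 0 ≤ Δ i j := fun i j => by simpa [Δ] using hle i j
  have hΔd : ∀ i, Δ i i = 0 := fun i => by simp [Δ, hdiag]
  have hsymm : ∀ {M : Matrix ι ι ℝ}, (M - c • (1 : Matrix ι ι ℝ)).PosSemidef → ∀ i j, M i j = M j i := by
    intro M hM i j
    have := hM.isHermitian.apply i j
    simp only [Matrix.sub_apply, Matrix.smul_apply, Matrix.one_apply, star_trivial, eq_comm] at this
    by_cases hij : i = j
    · rw [hij]
    · simpa [hij, Ne.symm hij, eq_comm] using this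
  have hΔs : ∀ i j, Δ i j = Δ j i := fun i j => by simp [Δ, hsymm hS i j, hsymm hT i j]
  -- One `m`-th of the way from `S` to `T` must consume at most the noise supply `c`.
  obtain ⟨m, hm⟩ := exists_nat_gt ((∑ p ∈ (Finset.univ : Finset ι).offDiag, Δ p.1 p.2 / 2) / c)
  have hm0 : (0 : ℝ) < m := lt_of_le_of_lt
    (div_nonneg (Finset.sum_nonneg fun p _ => by linarith [hΔ0 p.1 p.2]) hc.le) hm
  have hstep : ∀ k : ℕ, k ≤ m → orthantProb b S ≤ orthantProb b (S + ((k : ℝ) / m) • Δ) := by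
    intro k
    induction k with
    | zero => simp
    | succ k ih =>
      intro hk
      refine (ih (by omega)).trans ?_
      have hkm : (k : ℝ) / m ≤ 1 := by
        rw [div_le_one hm0]; exact_mod_cast (by omega : k ≤ m)
      -- By convexity the full supply `c` is available again at every point of the segment.
      have hpsd : (S + ((k : ℝ) / m) • Δ - c • (1 : Matrix ι ι ℝ)).PosSemidef := by
        have : S + ((k : ℝ) / m) • Δ - c • (1 : Matrix ι ι ℝ) =
            (1 - (k : ℝ) / m) • (S - c • 1) + ((k : ℝ) / m) • (T - c • 1) := by
          simp only [Δ]; module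
        rw [this]
        exact (hS.smul (sub_nonneg.2 hkm)).add (hT.smul (by positivity))
      have := orthantProb_le_add_sum_pairMatrix b (Finset.univ : Finset ι).offDiag
        (fun p hp => by simpa using hp) (θ := fun p => Δ p.1 p.2 / 2 / m)
        (fun p => by have := hΔ0 p.1 p.2; positivity) hpsd (by
          rw [← Finset.sum_div, div_le_iff₀ hm0]
          rw [div_lt_iff₀ hc] at hm; linarith)
      refine this.trans_eq ?_
      congr 1
      rw [add_assoc]
      congr 1
      have h2 : ∑ p ∈ (Finset.univ : Finset ι).offDiag, (Δ p.1 p.2 / 2 / m) • pairMatrix p =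
          (1 / (m : ℝ)) • Δ := by
        conv_rhs => rw [← sum_offDiag_pairMatrix hΔs hΔd]
        rw [Finset.smul_sum]
        refine Finset.sum_congr rfl fun p _ => ?_
        rw [smul_smul]; congr 1; ring
      rw [h2, ← add_smul]
      congr 1
      push_cast; ring
  have := hstep m le_rfl
  rwa [div_self hm0.ne', one_smul, add_sub_cancel] at this

end Slepian
end WeightedPersistence

namespace WeightedPersistence
open scoped Matrix RealInnerProductSpace ENNReal

/-! ### Slepian's inequality for degenerate covariances, by a vanishing perturbation. -/

section Slepian

variable {ι : Type*} [Fintype ι] [DecidableEq ι]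

lemma multivariateGaussian_add_smul_one {S : Matrix ι ι ℝ} (hS : S.PosSemidef) (c : ℝ) :
    multivariateGaussian 0 (S + c ^ 2 • (1 : Matrix ι ι ℝ)) =
      ((multivariateGaussian 0 S).prod (stdGaussian (EuclideanSpace ℝ ι))).map
        (fun p => p.1 + c • p.2) := by
  have hv : (c ^ 2 • (1 : Matrix ι ι ℝ)).PosSemidef := Matrix.PosSemidef.one.smul (sq_nonneg c)
  have hmeas : Measurable (fun p : EuclideanSpace ℝ ι × EuclideanSpace ℝ ι => p.1 + c • p.2) := by
    fun_prop
  have : IsProbabilityMeasure (((multivariateGaussian 0 S).prod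
      (stdGaussian (EuclideanSpace ℝ ι))).map (fun p => p.1 + c • p.2)) :=
    Measure.isProbabilityMeasure_map hmeas.aemeasurable
  apply Measure.ext_of_charFun
  ext t
  rw [charFun_multivariateGaussian (hS.add hv), charFun_apply,
    integral_map hmeas.aemeasurable (by fun_prop)]
  have : ∀ p : EuclideanSpace ℝ ι × EuclideanSpace ℝ ι,
      Complex.exp (⟪p.1 + c • p.2, t⟫ * Complex.I) =
      Complex.exp (⟪p.1, t⟫ * Complex.I) * Complex.exp (⟪p.2, c • t⟫ * Complex.I) := by
    intro p
    rw [← Complex.exp_add, inner_add_left, real_inner_smul_left, real_inner_smul_right]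
    congr 1
    push_cast
    ring
  simp_rw [this]
  rw [integral_prod_mul (fun x : EuclideanSpace ℝ ι => Complex.exp (⟪x, t⟫ * Complex.I))
    (fun x : EuclideanSpace ℝ ι => Complex.exp (⟪x, c • t⟫ * Complex.I)), ← charFun_apply,
    ← charFun_apply, charFun_multivariateGaussian hS, charFun_stdGaussian, ← Complex.exp_add]
  congr 1
  have h1 : t.ofLp ⬝ᵥ t.ofLp = ‖t‖ ^ 2 := by
    rw [EuclideanSpace.real_norm_sq_eq]
    simp [dotProduct, sq]
  rw [Matrix.add_mulVec, dotProduct_add, Matrix.smul_mulVec, Matrix.one_mulVec, dotProduct_smul,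
    h1, norm_smul]
  simp [mul_pow]
  norm_cast
  rw [sq_abs]
  ring

/-- Positive variances make every hyperplane `x i = b i` null, so the indicators of the orthant
converge almost surely as the added noise tends to zero. -/
lemma tendsto_orthantProb_add_smul_one (b : ι → ℝ) {S : Matrix ι ι ℝ} (hS : S.PosSemidef)
    (hpos : ∀ i, 0 < S i i) :
    Tendsto (fun k : ℕ => orthantProb b (S + (1 / ((k : ℝ) + 1)) ^ 2 • (1 : Matrix ι ι ℝ))) atTop
      (𝓝 (orthantProb b S)) := by
  set μ := (multivariateGaussian 0 S).prod (stdGaussian (EuclideanSpace ℝ ι))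
  have h1 : ∀ k : ℕ, orthantProb b (S + (1 / ((k : ℝ) + 1)) ^ 2 • (1 : Matrix ι ι ℝ)) =
      μ {p | ∀ i, p.1 i + (1 / ((k : ℝ) + 1)) * p.2 i < b i} := fun k => by
    rw [orthantProb, multivariateGaussian_add_smul_one hS, Measure.map_apply (by fun_prop)
      (measurableSet_orthant b)]
    rfl
  have h2 : orthantProb b S = μ {p | ∀ i, p.1 i < b i} := by
    have : {p : EuclideanSpace ℝ ι × EuclideanSpace ℝ ι | ∀ i, p.1 i < b i} =
      {x : EuclideanSpace ℝ ι | ∀ i, x i < b i} ×ˢ Set.univ := by ext; simp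
    rw [this, Measure.prod_prod, measure_univ, mul_one, orthantProb]
  have hm : ∀ c : ℝ, MeasurableSet {p : EuclideanSpace ℝ ι × EuclideanSpace ℝ ι |
      ∀ i, p.1 i + c * p.2 i < b i} := fun c => by
    rw [Set.ofPred_forall]
    exact MeasurableSet.iInter fun i => measurableSet_lt (by fun_prop) measurable_const
  simp_rw [h1, h2]
  have hm0 : MeasurableSet {p : EuclideanSpace ℝ ι × EuclideanSpace ℝ ι | ∀ i, p.1 i < b i} := by
    simpa using hm 0
  refine tendsto_measure_of_ae_tendsto_indicator_of_isFiniteMeasure atTop hm0 (fun k => hm _) ?_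
  have hne : ∀ᵐ p ∂μ, ∀ i, p.1 i ≠ b i := by
    rw [ae_all_iff]
    intro i
    have h3 : ∀ᵐ x ∂(multivariateGaussian 0 S), x i ≠ b i := by
      have hmp := measurePreserving_eval_multivariateGaussian (μ := 0) hS (i := i)
      have h4 : ∀ᵐ y ∂gaussianReal 0 (S i i).toNNReal, y ≠ b i := by
        have := nullSingletonClass_gaussianReal (μ := 0) (v := (S i i).toNNReal)
          (by simpa using hpos i)
        rw [ae_iff]; simp
      simpa using hmp.quasiMeasurePreserving.ae h4
    exact Measure.quasiMeasurePreserving_fst.ae h3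
  filter_upwards [hne] with p hp
  have hlim : ∀ i, Tendsto (fun k : ℕ => p.1 i + (1 / ((k : ℝ) + 1)) * p.2 i) atTop (𝓝 (p.1 i)) :=
    fun i => by
      simpa using tendsto_const_nhds.add
        (tendsto_one_div_add_atTop_nhds_zero_nat.mul_const (p.2 i))
  by_cases hlt : ∀ i, p.1 i < b i
  · have := eventually_all.2 fun i => (hlim i).eventually_lt_const (hlt i)
    filter_upwards [this] with k hk
    exact iff_of_true hk hlt
  · push Not at hlt
    obtain ⟨i, hi⟩ := hlt
    filter_upwards [(hlim i).eventually_const_lt (lt_of_le_of_ne hi (hp i).symm)] with k hk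
    exact iff_of_false (fun h => absurd (h i) (not_lt.2 hk.le))
      (fun h => absurd (h i) (not_lt.2 hi))

/-- **Slepian's inequality**. -/
theorem orthantProb_mono (b : ι → ℝ) {S T : Matrix ι ι ℝ} (hS : S.PosSemidef) (hT : T.PosSemidef)
    (hpos : ∀ i, 0 < S i i) (hdiag : ∀ i, S i i = T i i) (hle : ∀ i j, S i j ≤ T i j) :
    orthantProb b S ≤ orthantProb b T := by
  refine le_of_tendsto_of_tendsto' (tendsto_orthantProb_add_smul_one b hS hpos)
    (tendsto_orthantProb_add_smul_one b hT fun i => hdiag i ▸ hpos i) fun k => ?_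
  refine orthantProb_mono_of_nondegenerate b (c := (1 / ((k : ℝ) + 1)) ^ 2) (by positivity)
    (by simpa using hS) (by simpa using hT) (by simpa using hdiag) (by simpa using hle)

end Slepian
end WeightedPersistence

namespace WeightedPersistence
open scoped ENNReal NNReal

/-! ### Independent Gaussian walks and killing at zero. -/

section Walk

/-- The law of a sequence of independent standard Gaussian variables. -/
noncomputable def stdSeq : Measure (ℕ → ℝ) := Measure.infinitePi fun _ => gaussianReal 0 1

instance : IsProbabilityMeasure stdSeq := by unfold stdSeq; infer_instance

/-- The random walk with increments `c i * x i`. -/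
def walk (c : ℕ → ℝ) (k : ℕ) (x : ℕ → ℝ) : ℝ := ∑ i ∈ Finset.range k, c i * x i

/-- The event that the walk is negative at the times `1, …, k`. -/
def walkNeg (c : ℕ → ℝ) (k : ℕ) : Set (ℕ → ℝ) := {x | ∀ l ∈ Finset.Icc 1 k, walk c l x < 0}

lemma measurable_walk (c : ℕ → ℝ) (k : ℕ) : Measurable (walk c k) := by
  unfold walk; fun_prop

lemma measurableSet_walkNeg (c : ℕ → ℝ) (k : ℕ) : MeasurableSet (walkNeg c k) := by
  simp only [walkNeg, Set.ofPred_forall]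
  exact MeasurableSet.iInter fun l => MeasurableSet.iInter fun _ =>
    measurableSet_lt (measurable_walk c l) measurable_const

lemma walk_update (c : ℕ → ℝ) {k l : ℕ} (hl : l ≤ k) (x : ℕ → ℝ) (y : ℝ) :
    walk c l (Function.update x k y) = walk c l x := by
  refine Finset.sum_congr rfl fun i hi => ?_
  rw [Function.update_of_ne]
  have := Finset.mem_range.1 hi; omega

lemma walk_succ_update (c : ℕ → ℝ) (k : ℕ) (x : ℕ → ℝ) (y : ℝ) :
    walk c (k + 1) (Function.update x k y) = walk c k x + c k * y := by
  rw [← walk_update c le_rfl x y]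
  simp [walk, Finset.sum_range_succ]

lemma update_mem_walkNeg_succ (c : ℕ → ℝ) (k : ℕ) (x : ℕ → ℝ) (y : ℝ) :
    Function.update x k y ∈ walkNeg c (k + 1) ↔ x ∈ walkNeg c k ∧ walk c k x + c k * y < 0 := by
  simp only [walkNeg, Set.mem_ofPred_eq, Finset.mem_Icc]
  constructor
  · intro h
    refine ⟨fun l hl => ?_, ?_⟩
    · rw [← walk_update c hl.2 x y]; exact h l ⟨hl.1, by omega⟩
    · rw [← walk_succ_update]; exact h (k + 1) ⟨by omega, le_rfl⟩
  · rintro ⟨h1, h2⟩ l ⟨hl1, hl2⟩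
    rcases Nat.lt_or_ge l (k + 1) with hlt | hge
    · rw [walk_update c (by omega)]; exact h1 l ⟨hl1, by omega⟩
    · obtain rfl : l = k + 1 := by omega
      rwa [walk_succ_update]

lemma measurable_update_prod (k : ℕ) :
    Measurable fun p : (ℕ → ℝ) × ℝ => Function.update p.1 k p.2 := by
  rw [measurable_pi_iff]
  intro i
  by_cases hi : i = k
  · subst hi; simpa using measurable_snd
  · simp only [Function.update_of_ne hi]; fun_prop

/-- Resampling one coordinate preserves the product law. Since the walk up to time `k` ignores
coordinate `k`, this replaces conditioning on the past. -/
lemma map_update_stdSeq (k : ℕ) :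
    (stdSeq.prod (gaussianReal 0 1)).map (fun p => Function.update p.1 k p.2) = stdSeq := by
  refine Measure.eq_infinitePi _ fun s t ht => ?_
  rw [Measure.map_apply (measurable_update_prod k)
    (MeasurableSet.pi s.countable_toSet fun i _ => ht i)]
  have h1 : (fun p : (ℕ → ℝ) × ℝ => Function.update p.1 k p.2) ⁻¹' Set.pi s t =
      (Set.pi (s.erase k : Finset ℕ) t) ×ˢ (if k ∈ s then t k else Set.univ) := by
    ext p
    simp only [Set.mem_preimage, Set.mem_pi, Finset.mem_coe, Set.mem_prod, Finset.mem_erase]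
    constructor
    · intro h
      refine ⟨fun i hi => by simpa [hi.1] using h i hi.2, ?_⟩
      split_ifs with hk
      · simpa using h k hk
      · trivial
    · rintro ⟨h1, h2⟩ i hi
      by_cases hik : i = k
      · subst hik; simpa [hi] using h2
      · simpa [hik] using h1 i ⟨hik, hi⟩
  rw [h1, Measure.prod_prod, stdSeq, Measure.infinitePi_pi _ fun i _ => ht i]
  split_ifs with hk
  · rw [Finset.prod_erase_mul _ _ hk]
  · rw [Finset.erase_eq_of_notMem hk]; simp

/-- One step of the Markov property of the walk killed when it becomes nonnegative. -/
lemma lintegral_walkNeg_succ (c : ℕ → ℝ) (k : ℕ) {h : ℝ → ℝ≥0∞} (hh : Measurable h) :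
    ∫⁻ x in walkNeg c (k + 1), h (walk c (k + 1) x) ∂stdSeq =
      ∫⁻ x in walkNeg c k, ∫⁻ y, (Set.Iio 0).indicator h (walk c k x + c k * y)
        ∂gaussianReal 0 1 ∂stdSeq := by
  have hm : Measurable ((walkNeg c (k + 1)).indicator fun x => h (walk c (k + 1) x)) :=
    (hh.comp (measurable_walk c _)).indicator (measurableSet_walkNeg c _)
  rw [← lintegral_indicator (measurableSet_walkNeg c _),
    ← lintegral_indicator (measurableSet_walkNeg c _)]
  conv_lhs => rw [← map_update_stdSeq k]
  rw [lintegral_map hm (measurable_update_prod k), lintegral_prod]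
  swap
  · exact (hm.comp (measurable_update_prod k)).aemeasurable
  refine lintegral_congr fun x => ?_
  by_cases hx : x ∈ walkNeg c k
  · rw [Set.indicator_of_mem hx]
    refine lintegral_congr fun y => ?_
    by_cases hy : walk c k x + c k * y < 0
    · rw [Set.indicator_of_mem ((update_mem_walkNeg_succ c k x y).2 ⟨hx, hy⟩),
        Set.indicator_of_mem (Set.mem_Iio.2 hy), walk_succ_update]
    · rw [Set.indicator_of_notMem (fun h => hy ((update_mem_walkNeg_succ c k x y).1 h).2),
        Set.indicator_of_notMem (fun h => hy (Set.mem_Iio.1 h))]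
  · rw [Set.indicator_of_notMem hx]
    simp [Set.indicator_of_notMem (fun h => hx ((update_mem_walkNeg_succ c k x _).1 h).1)]

lemma walkNeg_zero (c : ℕ → ℝ) : walkNeg c 0 = Set.univ := by
  ext x; simp [walkNeg]

lemma walk_zero (c : ℕ → ℝ) (x : ℕ → ℝ) : walk c 0 x = 0 := by simp [walk]

end Walk

/-! ### One killed step of a standard Gaussian walk. -/

section Kill

lemma integrable_id_stdGaussianReal : Integrable (fun y : ℝ => y) (gaussianReal 0 1) :=
  (memLp_id_gaussianReal 1).integrable (by simp)

lemma integrable_gaussianPDFReal_mul {f : ℝ → ℝ} (hf : Integrable f (gaussianReal 0 1)) :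
    Integrable (fun u => gaussianPDFReal 0 1 u * f u) := by
  rw [gaussianReal_of_var_ne_zero _ one_ne_zero, integrable_withDensity_iff_integrable_smul'
    (measurable_gaussianPDF _ _) (ae_of_all _ fun _ => gaussianPDF_lt_top)] at hf
  simpa [toReal_gaussianPDF] using hf

/-- Integrate `1 - |y| ≥ (1 - y²) / 2`, whose right side has mean zero. -/
lemma integral_gaussian_one_sub_abs_nonneg : 0 ≤ ∫ y, (1 - |y|) ∂gaussianReal 0 1 := by
  have h2 : ∫ y, y ^ 2 ∂gaussianReal 0 1 = 1 := by
    have := variance_id_gaussianReal (μ := 0) (v := 1)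
    rw [variance_eq_integral (by fun_prop)] at this
    simpa using this
  have hi2 : Integrable (fun y : ℝ => y ^ 2) (gaussianReal 0 1) :=
    (memLp_id_gaussianReal 2).integrable_sq
  have hi1 : Integrable (fun y : ℝ => |y|) (gaussianReal 0 1) :=
    integrable_id_stdGaussianReal.abs
  have h3 : ∫ y, (1 - y ^ 2) / 2 ∂gaussianReal 0 1 = 0 := by
    rw [integral_div, integral_sub (integrable_const _) hi2, h2]; simp
  have hi3 : Integrable (fun y : ℝ => (1 - y ^ 2) / 2) (gaussianReal 0 1) :=
    ((integrable_const 1).sub hi2).div_const 2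
  have hi4 : Integrable (fun y : ℝ => 1 - |y|) (gaussianReal 0 1) := (integrable_const 1).sub hi1
  refine h3.symm.le.trans (integral_mono hi3 hi4 fun y => ?_)
  have := sq_abs y
  simp only
  nlinarith [sq_nonneg (|y| - 1)]

lemma integral_pdf_one_sub_nonneg :
    0 ≤ ∫ u in Set.Ioi 0, gaussianPDFReal 0 1 u * (1 - u) := by
  have h := integral_gaussian_one_sub_abs_nonneg
  rw [integral_gaussianReal_eq_integral_smul one_ne_zero] at h
  have h2 := integral_comp_abs (f := fun u => gaussianPDFReal 0 1 u * (1 - u))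
  have h3 : ∀ u : ℝ, gaussianPDFReal 0 1 |u| = gaussianPDFReal 0 1 u := fun u => by
    simp [gaussianPDFReal]
  simp only [h3, smul_eq_mul] at h h2
  linarith

/-- The mean excess of a standard Gaussian variable over a nonnegative level is at most one. -/
lemma integral_excess_nonneg {z : ℝ} (hz : 0 ≤ z) :
    0 ≤ ∫ y in Set.Ici z, (z + 1 - y) ∂gaussianReal 0 1 := by
  have hint : Integrable (fun u : ℝ => gaussianPDFReal 0 1 u * (1 - u)) :=
    integrable_gaussianPDFReal_mul ((integrable_const 1).sub integrable_id_stdGaussianReal)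
  have hint2 : Integrable (fun u : ℝ => gaussianPDFReal 0 1 (u + z) * (1 - u)) := by
    have := (integrable_gaussianPDFReal_mul
      ((integrable_const (1 + z)).sub integrable_id_stdGaussianReal)).comp_add_right z
    refine this.congr (ae_of_all _ fun u => ?_)
    simp only [Pi.sub_apply]
    congr 1; ring
  rw [← integral_indicator measurableSet_Ici, integral_gaussianReal_eq_integral_smul one_ne_zero,
    ← integral_add_right_eq_self _ z]
  have h1 : ∀ u : ℝ, gaussianPDFReal 0 1 (u + z) •
      (Set.Ici z).indicator (fun y => z + 1 - y) (u + z) =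
      (Set.Ici 0).indicator (fun u => gaussianPDFReal 0 1 (u + z) * (1 - u)) u := by
    intro u
    by_cases hu : 0 ≤ u
    · rw [Set.indicator_of_mem (by simpa using hu), Set.indicator_of_mem (by simpa using hu)]
      rw [smul_eq_mul]; congr 1; ring
    · rw [Set.indicator_of_notMem (by simpa using hu), Set.indicator_of_notMem (by simpa using hu)]
      simp
  simp_rw [h1]
  rw [integral_indicator measurableSet_Ici, integral_Ici_eq_integral_Ioi]
  -- The shift by `z` multiplies the density by `exp (-u z)` and a constant. As `exp (-u z)`
  -- decreases and `1 - u` changes sign at `u = 1`, freezing the exponential at `u = 1` only lowers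
  -- the integrand.
  have h2 : ∫ u in Set.Ioi 0, Real.exp (-z - z ^ 2 / 2) * (gaussianPDFReal 0 1 u * (1 - u)) ≤
      ∫ u in Set.Ioi 0, gaussianPDFReal 0 1 (u + z) * (1 - u) := by
    refine setIntegral_mono_on (hint.integrableOn.const_mul _) hint2.integrableOn
      measurableSet_Ioi fun u hu => ?_
    have h3 : gaussianPDFReal 0 1 (u + z) =
        gaussianPDFReal 0 1 u * (Real.exp (-(u * z)) * Real.exp (-z ^ 2 / 2)) := by
      simp only [gaussianPDFReal, mul_assoc, ← Real.exp_add]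
      congr 3
      simp; ring
    have h4 : Real.exp (-z - z ^ 2 / 2) = Real.exp (-z) * Real.exp (-z ^ 2 / 2) := by
      rw [← Real.exp_add]; congr 1; ring
    rw [h3, h4]
    have h5 : 0 ≤ gaussianPDFReal 0 1 u * Real.exp (-z ^ 2 / 2) :=
      mul_nonneg (gaussianPDFReal_nonneg _ _ _) (Real.exp_pos _).le
    have h6 : Real.exp (-z) * (1 - u) ≤ Real.exp (-(u * z)) * (1 - u) := by
      rcases le_total u 1 with h | h
      · refine mul_le_mul_of_nonneg_right (Real.exp_le_exp.2 ?_) (by linarith)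
        nlinarith
      · refine mul_le_mul_of_nonpos_right (Real.exp_le_exp.2 ?_) (by linarith)
        nlinarith
    nlinarith [mul_le_mul_of_nonneg_left h6 h5]
  refine le_trans ?_ h2
  rw [integral_const_mul]
  exact mul_nonneg (Real.exp_pos _).le integral_pdf_one_sub_nonneg

/-- Without killing the mean is `z + β`. Killing removes the integral of `(z + 1 - y) + (β - 1)`
over `y ≥ z`; the first part is nonnegative by `integral_excess_nonneg`, and `β - 1 ≥ 1`. -/
lemma lintegral_kill_le {z β : ℝ} (hz : 0 ≤ z) (hβ : 2 ≤ β) :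
    ∫⁻ y, (Set.Iio 0).indicator (fun w => ENNReal.ofReal (-w + β)) (-z + y) ∂gaussianReal 0 1 ≤
      ENNReal.ofReal (z + β - (gaussianReal 0 1).real (Set.Ici z)) := by
  have hid := integrable_id_stdGaussianReal
  have h1 : ∀ y : ℝ, (Set.Iio 0).indicator (fun w => ENNReal.ofReal (-w + β)) (-z + y) =
      ENNReal.ofReal ((Set.Iio z).indicator (fun y => z - y + β) y) := by
    intro y
    by_cases hy : y < z
    · rw [Set.indicator_of_mem (by simpa using hy), Set.indicator_of_mem (by simpa using hy)]
      congr 1; ring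
    · rw [Set.indicator_of_notMem (by simpa using hy), Set.indicator_of_notMem (by simpa using hy)]
      simp
  simp_rw [h1]
  have hf : Integrable (fun y : ℝ => z - y + β) (gaussianReal 0 1) :=
    ((integrable_const z).sub hid).add (integrable_const β)
  have hf1 : Integrable (fun y : ℝ => z + 1 - y) (gaussianReal 0 1) :=
    (integrable_const (z + 1)).sub hid
  rw [← ofReal_integral_eq_lintegral_ofReal (hf.indicator measurableSet_Iio)
    (ae_of_all _ fun y => Set.indicator_nonneg (fun y hy => by
      have := Set.mem_Iio.1 hy; linarith) y)]
  refine ENNReal.ofReal_le_ofReal ?_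
  rw [integral_indicator measurableSet_Iio]
  have h2 := integral_add_compl measurableSet_Iio (s := Set.Iio z) hf
  have h3 : ∫ y, (z - y + β) ∂gaussianReal 0 1 = z + β := by
    have : ∀ y : ℝ, z - y + β = (z + β) - y := fun y => by ring
    simp_rw [this]
    rw [integral_sub (integrable_const _) hid]
    simp
  rw [Set.compl_Iio] at h2
  have h4 : ∫ y in Set.Ici z, (z - y + β) ∂gaussianReal 0 1 =
      ∫ y in Set.Ici z, (z + 1 - y) ∂gaussianReal 0 1 +
        (β - 1) * (gaussianReal 0 1).real (Set.Ici z) := by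
    have : ∀ y, z - y + β = (z + 1 - y) + (β - 1) := fun y => by ring
    simp_rw [this]
    rw [integral_add hf1.integrableOn (integrable_const _)]
    simp [mul_comm]
  have h5 := integral_excess_nonneg hz
  have h6 : 0 ≤ (gaussianReal 0 1).real (Set.Ici z) := measureReal_nonneg
  nlinarith

end Kill
end WeightedPersistence

namespace WeightedPersistence
open scoped ENNReal NNReal

/-! ### Upper bound for the independent walk. -/

section WalkUpper

/-- The standard deviation of the walk at time `k`. -/
noncomputable def walkSd (c : ℕ → ℝ) (k : ℕ) : ℝ := √(∑ i ∈ Finset.range k, c i ^ 2)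

lemma walkSd_sq (c : ℕ → ℝ) (k : ℕ) : walkSd c k ^ 2 = ∑ i ∈ Finset.range k, c i ^ 2 :=
  Real.sq_sqrt (Finset.sum_nonneg fun _ _ => sq_nonneg _)

lemma walkSd_pos {c : ℕ → ℝ} (hc : ∀ k, 0 < c k) {k : ℕ} (hk : 1 ≤ k) : 0 < walkSd c k :=
  Real.sqrt_pos.2 (Finset.sum_pos (fun i _ => pow_pos (hc i) 2) ⟨0, Finset.mem_range.2 hk⟩)

/-- In one step the offset `b τ` grows by at most `c η`. Close to zero the mass lost by killing pays
for this; farther than `c / δ` from zero, it is at most a proportion `δ η` of the current value. -/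
lemma lintegral_kill_scaled_le {c x τ τ' b δ η : ℝ} (hc : 0 < c) (hx : x < 0) (hτ : 0 < τ)
    (hτ' : 0 ≤ τ') (hττ' : τ' ^ 2 = τ ^ 2 + c ^ 2) (hδ : 0 < δ) (hη : 0 < η) (hb : 0 < b)
    (hbη : b ^ 2 = 4 * η) (hcτ : c ^ 2 ≤ η * τ ^ 2)
    (hQ : η ≤ (gaussianReal 0 1).real (Set.Ici (1 / δ))) :
    ∫⁻ y, (Set.Iio 0).indicator (fun w => ENNReal.ofReal (-w + b * τ')) (x + c * y)
        ∂gaussianReal 0 1 ≤ ENNReal.ofReal ((1 + δ * η) * (-x + b * τ)) := by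
  have hlt : τ ≤ τ' := abs_le_of_sq_le_sq' (by nlinarith) hτ' |>.2
  -- The normalisation `b² = 4 η` serves to obtain the offset `2` required by `lintegral_kill_le`
  -- after division by `c`.
  have h2c : 2 * c ≤ b * τ := abs_le_of_sq_le_sq' (by nlinarith) (by positivity) |>.2
  have hβ : 2 ≤ b * τ' / c := by rw [le_div_iff₀ hc]; nlinarith
  have hz : 0 ≤ -x / c := div_nonneg (by linarith) hc.le
  have h1 : ∀ y, (Set.Iio 0).indicator (fun w => ENNReal.ofReal (-w + b * τ')) (x + c * y) =
      ENNReal.ofReal c *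
        (Set.Iio 0).indicator (fun w => ENNReal.ofReal (-w + b * τ' / c)) (-(-x / c) + y) := by
    intro y
    have h : x + c * y = c * (-(-x / c) + y) := by field_simp
    by_cases hy : x + c * y < 0
    · have hy' : -(-x / c) + y < 0 := by
        rw [h] at hy; exact (pos_iff_neg_of_mul_neg hy).1 hc
      rw [Set.indicator_of_mem (Set.mem_Iio.2 hy), Set.indicator_of_mem (Set.mem_Iio.2 hy'),
        ← ENNReal.ofReal_mul hc.le]
      congr 1
      field_simp
    · have hy' : ¬ (-(-x / c) + y < 0) := fun h' => hy (by rw [h]; exact mul_neg_of_pos_of_neg hc h')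
      rw [Set.indicator_of_notMem (fun h => hy (Set.mem_Iio.1 h)),
        Set.indicator_of_notMem (fun h => hy' (Set.mem_Iio.1 h)), mul_zero]
  simp_rw [h1]
  rw [lintegral_const_mul' _ _ ENNReal.ofReal_ne_top]
  grw [lintegral_kill_le hz hβ]
  rw [← ENNReal.ofReal_mul hc.le]
  refine ENNReal.ofReal_le_ofReal ?_
  set Q := (gaussianReal 0 1).real (Set.Ici (-x / c))
  have hQ0 : 0 ≤ Q := measureReal_nonneg
  have h3 : c * (-x / c + b * τ' / c - Q) = -x + b * τ' - c * Q := by field_simp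
  have h4 : b * τ' ≤ b * τ + c * η := by
    have h5 : (τ' - τ) * (2 * τ) ≤ c ^ 2 := by nlinarith
    have h6 : b * c ≤ 2 * η * τ := by nlinarith
    have h7 : b * (τ' - τ) * (2 * τ) ≤ c * η * (2 * τ) := by nlinarith
    have := le_of_mul_le_mul_right h7 (by positivity)
    linarith
  have h5 : c * η ≤ c * Q + δ * η * (-x + b * τ) := by
    rcases le_total (1 / δ) (-x / c) with h | h
    · rw [div_le_div_iff₀ hδ hc, one_mul] at h
      have : η * c ≤ η * (-x * δ) := mul_le_mul_of_nonneg_left h hη.le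
      have h8 : 0 ≤ δ * η * (b * τ) := by positivity
      nlinarith [mul_nonneg hc.le hQ0]
    · have : η ≤ Q := hQ.trans (measureReal_mono (Set.Ici_subset_Ici.2 h))
      have h8 : 0 ≤ δ * η * (-x + b * τ) :=
        mul_nonneg (by positivity) (add_nonneg (by linarith) (by positivity))
      nlinarith [mul_le_mul_of_nonneg_left this hc.le]
  rw [h3]
  linarith

/-- If the increments of the walk are small compared with its past standard deviation, then the
persistence probability decays at most slightly slower than the inverse standard deviation. -/
lemma walkNeg_real_le {c : ℕ → ℝ} (hc : ∀ k, 0 < c k) {δ η b : ℝ} (hδ : 0 < δ) (hη : 0 < η)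
    (hb : 0 < b) (hbη : b ^ 2 = 4 * η) (hcτ : ∀ k, 1 ≤ k → c k ^ 2 ≤ η * walkSd c k ^ 2)
    (hQ : η ≤ (gaussianReal 0 1).real (Set.Ici (1 / δ))) (n : ℕ) :
    stdSeq.real (walkNeg c (n + 1)) ≤
      (1 + δ * η) ^ n * ((2 + b) * c 0) / (b * walkSd c (n + 1)) := by
  set h : ℕ → ℝ → ℝ≥0∞ := fun k w => ENNReal.ofReal (-w + b * walkSd c k)
  have hm : ∀ k, Measurable (h k) := fun k => by fun_prop
  have hV : ∀ n, ∫⁻ x in walkNeg c (n + 1), h (n + 1) (walk c (n + 1) x) ∂stdSeq ≤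
      ENNReal.ofReal ((1 + δ * η) ^ n * ((2 + b) * c 0)) := by
    intro n
    induction n with
    | zero =>
      rw [lintegral_walkNeg_succ c 0 (hm _), walkNeg_zero]
      simp only [Measure.restrict_univ, walk_zero, lintegral_const, measure_univ, mul_one]
      have hsd : walkSd c (0 + 1) = c 0 := by simp [walkSd, Real.sqrt_sq (hc 0).le]
      -- The first step starts from standard deviation zero, so smallness of the increment is not
      -- available; the offset is raised from `b` to `2 + b` instead.
      have h1 : ∀ y, (Set.Iio 0).indicator (h (0 + 1)) (0 + c 0 * y) ≤ ENNReal.ofReal (c 0) *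
          (Set.Iio 0).indicator (fun w => ENNReal.ofReal (-w + (2 + b))) (-0 + y) := by
        intro y
        by_cases hy : y < 0
        · have hy' : c 0 * y < 0 := mul_neg_of_pos_of_neg (hc 0) hy
          rw [Set.indicator_of_mem (by simpa using hy'), Set.indicator_of_mem (by simpa using hy),
            ← ENNReal.ofReal_mul (hc 0).le]
          refine ENNReal.ofReal_le_ofReal ?_
          rw [hsd]
          nlinarith [hc 0]
        · have hy' : ¬ c 0 * y < 0 := by
            simpa using mul_nonneg (hc 0).le (not_lt.1 hy)
          rw [Set.indicator_of_notMem (by simpa using hy')]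
          exact zero_le
      refine (lintegral_mono h1).trans ?_
      rw [lintegral_const_mul' _ _ ENNReal.ofReal_ne_top]
      grw [lintegral_kill_le le_rfl (by linarith : 2 ≤ 2 + b)]
      rw [← ENNReal.ofReal_mul (hc 0).le]
      refine ENNReal.ofReal_le_ofReal ?_
      have : 0 ≤ (gaussianReal 0 1).real (Set.Ici 0) := measureReal_nonneg
      nlinarith [hc 0, mul_nonneg (hc 0).le this]
    | succ n ih =>
      rw [lintegral_walkNeg_succ c (n + 1) (hm _)]
      have h1 : ∀ x ∈ walkNeg c (n + 1), ∫⁻ y, (Set.Iio 0).indicator (h (n + 1 + 1))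
          (walk c (n + 1) x + c (n + 1) * y) ∂gaussianReal 0 1 ≤
          ENNReal.ofReal (1 + δ * η) * h (n + 1) (walk c (n + 1) x) := by
        intro x hx
        have hx0 : walk c (n + 1) x < 0 := hx _ (by simp)
        rw [← ENNReal.ofReal_mul (by positivity)]
        refine lintegral_kill_scaled_le (hc _) hx0 (walkSd_pos hc (by omega))
          (walkSd_pos hc (by omega)).le ?_ hδ hη hb hbη (hcτ _ (by omega)) hQ
        rw [walkSd_sq, walkSd_sq, Finset.sum_range_succ]
      refine (setLIntegral_mono' (measurableSet_walkNeg c _) h1).trans ?_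
      rw [lintegral_const_mul' _ _ ENNReal.ofReal_ne_top]
      grw [ih]
      rw [← ENNReal.ofReal_mul (by positivity)]
      refine ENNReal.ofReal_le_ofReal (le_of_eq ?_)
      ring
  have hsd := walkSd_pos hc (by omega : 1 ≤ n + 1)
  -- Markov's inequality: a surviving walk has potential at least `b * walkSd`.
  have h2 : ENNReal.ofReal (b * walkSd c (n + 1)) * stdSeq (walkNeg c (n + 1)) ≤
      ENNReal.ofReal ((1 + δ * η) ^ n * ((2 + b) * c 0)) := by
    refine le_trans ?_ (hV n)
    rw [← setLIntegral_const]
    refine setLIntegral_mono' (measurableSet_walkNeg c _) fun x hx => ENNReal.ofReal_le_ofReal ?_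
    have hx0 : walk c (n + 1) x < 0 := hx _ (by simp)
    linarith
  have hc0 := hc 0
  have h3 := ENNReal.toReal_mono ENNReal.ofReal_ne_top h2
  rw [ENNReal.toReal_mul, ENNReal.toReal_ofReal (by positivity),
    ENNReal.toReal_ofReal (by positivity)] at h3
  rw [le_div_iff₀ (by positivity), mul_comm]
  exact h3

end WalkUpper

/-! ### Lower bound for the independent walk. -/

section WalkLower

/-- The probability that a centred Gaussian variable of variance `V` has absolute value less than
`z`, extended to an odd function of `z`. -/
noncomputable def oddMass (V : ℝ≥0) (z : ℝ) : ℝ :=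
  (gaussianReal 0 V).real (Set.Iio z) - (gaussianReal 0 V).real (Set.Ioi z)

lemma gaussianReal_real_Ioi (V : ℝ≥0) (z : ℝ) :
    (gaussianReal 0 V).real (Set.Ioi z) = (gaussianReal 0 V).real (Set.Iio (-z)) := by
  have h := gaussianReal_map_neg (μ := 0) (v := V)
  rw [neg_zero] at h
  conv_lhs => rw [← h]
  rw [map_measureReal_apply measurable_neg measurableSet_Ioi]
  congr 1; ext y; simp

lemma oddMass_mono (V : ℝ≥0) : Monotone (oddMass V) := fun _ _ h =>
  sub_le_sub (measureReal_mono (Set.Iio_subset_Iio h)) (measureReal_mono (Set.Ioi_subset_Ioi h))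

lemma oddMass_nonpos (V : ℝ≥0) {z : ℝ} (hz : z ≤ 0) : oddMass V z ≤ 0 := by
  rw [oddMass, gaussianReal_real_Ioi, sub_nonpos]
  exact measureReal_mono (Set.Iio_subset_Iio (by linarith))

lemma oddMass_le_one (V : ℝ≥0) (z : ℝ) : oddMass V z ≤ 1 := by
  have h1 : (gaussianReal 0 V).real (Set.Iio z) ≤ 1 := measureReal_le_one
  have h2 : 0 ≤ (gaussianReal 0 V).real (Set.Ioi z) := measureReal_nonneg
  rw [oddMass]; linarith

lemma integral_gaussianReal_real (V : ℝ≥0) (c : ℝ) {A : Set ℝ} (hA : MeasurableSet A) :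
    Integrable (fun y => (gaussianReal 0 V).real {x | x + c * y ∈ A}) (gaussianReal 0 1) ∧
    ∫ y, (gaussianReal 0 V).real {x | x + c * y ∈ A} ∂gaussianReal 0 1 =
      (gaussianReal 0 (V + NNReal.mk (c ^ 2) (sq_nonneg c))).real A := by
  have hmeas : MeasurableSet {p : ℝ × ℝ | p.1 + c * p.2 ∈ A} := by
    exact hA.preimage (f := fun p : ℝ × ℝ => p.1 + c * p.2) (by fun_prop)
  have hm : Measurable fun y => gaussianReal 0 V {x | x + c * y ∈ A} :=
    measurable_measure_prodMk_right hmeas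
  constructor
  · refine Integrable.of_bound hm.ennreal_toReal.aestronglyMeasurable 1 (ae_of_all _ fun y => ?_)
    rw [Real.norm_of_nonneg measureReal_nonneg]
    exact measureReal_le_one
  · have h1 : gaussianReal 0 (V + NNReal.mk (c ^ 2) (sq_nonneg c)) =
        ((gaussianReal 0 V).prod (gaussianReal 0 1)).map (fun p => p.1 + c * p.2) := by
      have h2 := gaussianReal_map_const_mul (μ := 0) (v := 1) c
      have h3 := gaussianReal_conv_gaussianReal (m₁ := 0) (m₂ := 0) (v₁ := V)
        (v₂ := NNReal.mk (c ^ 2) (sq_nonneg c))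
      rw [mul_zero, mul_one] at h2
      rw [add_zero, ← h2, Measure.conv] at h3
      rw [← h3]
      conv_lhs => rw [← Measure.map_id (μ := gaussianReal 0 V)]
      rw [Measure.map_prod_map _ _ measurable_id (by fun_prop),
        Measure.map_map (by fun_prop) (by fun_prop)]
      rfl
    rw [h1, map_measureReal_apply (by fun_prop) hA, measureReal_def,
      Measure.prod_apply_symm (hA.preimage (by fun_prop))]
    exact integral_toReal hm.aemeasurable (ae_of_all _ fun y => measure_lt_top _ _)

/-- `oddMass V` is the sign function smoothed by a Gaussian of variance `V`, so one more Gaussian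
step adds variances. -/
lemma integral_oddMass (V : ℝ≥0) (c z : ℝ) :
    Integrable (fun y => oddMass V (z - c * y)) (gaussianReal 0 1) ∧
    ∫ y, oddMass V (z - c * y) ∂gaussianReal 0 1 = oddMass (V + NNReal.mk (c ^ 2) (sq_nonneg c)) z := by
  have h1 : ∀ y, oddMass V (z - c * y) = (gaussianReal 0 V).real {x | x + c * y ∈ Set.Iio z} -
      (gaussianReal 0 V).real {x | x + c * y ∈ Set.Ioi z} := fun y => by
    rw [oddMass]; congr 2 <;> ext x <;> simp [lt_sub_iff_add_lt, sub_lt_iff_lt_add]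
  obtain ⟨h2, h3⟩ := integral_gaussianReal_real V c (measurableSet_Iio (a := z))
  obtain ⟨h4, h5⟩ := integral_gaussianReal_real V c (measurableSet_Ioi (a := z))
  simp_rw [h1]
  refine ⟨h2.sub h4, ?_⟩
  rw [integral_sub h2 h4, h3, h5, oddMass]

/-- Within one standard deviation the density is at least `exp (-1/2)` times its peak. -/
lemma le_oddMass {V : ℝ≥0} (hV : V ≠ 0) {z : ℝ} (hz : 0 ≤ z) (hzV : z ^ 2 ≤ V) :
    2 * Real.exp (-(1 / 2)) / √(2 * Real.pi) * (z / √V) ≤ oddMass V z := by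
  have hV0 : (0 : ℝ) < V := by positivity
  have h1 : (gaussianReal 0 V).real (Set.Ioo (-z) z) ≤ oddMass V z := by
    have hd : Disjoint (Set.Iio (-z)) (Set.Ioo (-z) z) :=
      Set.disjoint_left.2 fun y hy hy' => lt_asymm hy hy'.1
    have hsub : Set.Iio (-z) ∪ Set.Ioo (-z) z ⊆ Set.Iio z :=
      Set.union_subset (Set.Iio_subset_Iio (by linarith)) fun y hy => hy.2
    rw [oddMass, gaussianReal_real_Ioi, le_sub_iff_add_le', ← measureReal_union hd measurableSet_Ioo]
    exact measureReal_mono hsub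
  have h2 : Real.exp (-(1 / 2)) / √(2 * Real.pi * V) * (2 * z) ≤
      (gaussianReal 0 V).real (Set.Ioo (-z) z) := by
    rw [measureReal_def, gaussianReal_apply_eq_integral _ hV, ENNReal.toReal_ofReal
      (integral_nonneg fun y => gaussianPDFReal_nonneg _ _ _)]
    have h3 : ∫ y in Set.Ioo (-z) z, Real.exp (-(1 / 2)) / √(2 * Real.pi * V) ≤
        ∫ y in Set.Ioo (-z) z, gaussianPDFReal 0 V y := by
      refine setIntegral_mono_on (integrable_const _) (integrable_gaussianPDFReal _ _).integrableOn
        measurableSet_Ioo fun y hy => ?_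
      rw [gaussianPDFReal, div_eq_inv_mul]
      refine mul_le_mul_of_nonneg_left (Real.exp_le_exp.2 ?_) (by positivity)
      have : y ^ 2 ≤ z ^ 2 := sq_le_sq' hy.1.le hy.2.le
      rw [sub_zero, neg_div, neg_le_neg_iff, div_le_div_iff₀ (by positivity) two_pos]
      linarith
    refine le_trans (le_of_eq ?_) h3
    rw [setIntegral_const]
    simp [Real.volume_real_Ioo_of_le (by linarith : -z ≤ z)]
    ring
  refine le_trans (le_of_eq ?_) (h2.trans h1)
  rw [Real.sqrt_mul (by positivity : 0 ≤ 2 * Real.pi)]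
  ring

/-- Killing discards only points where the odd function is nonpositive, so it cannot lower the mean.
-/
lemma lintegral_oddMass_le (V : ℝ≥0) (c x : ℝ) :
    ENNReal.ofReal (oddMass (V + NNReal.mk (c ^ 2) (sq_nonneg c)) (-x)) ≤
      ∫⁻ y, (Set.Iio 0).indicator (fun w => ENNReal.ofReal (oddMass V (-w))) (x + c * y)
        ∂gaussianReal 0 1 := by
  obtain ⟨h1, h2⟩ := integral_oddMass V c (-x)
  have h3 : ∀ y, (Set.Iio 0).indicator (fun w => ENNReal.ofReal (oddMass V (-w))) (x + c * y) =
      ENNReal.ofReal (max (oddMass V (-x - c * y)) 0) := by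
    intro y
    have h4 : -(x + c * y) = -x - c * y := by ring
    by_cases hy : x + c * y < 0
    · rw [Set.indicator_of_mem (Set.mem_Iio.2 hy), h4, ENNReal.ofReal_max]; simp
    · rw [Set.indicator_of_notMem (fun h => hy (Set.mem_Iio.1 h)), max_eq_right, ENNReal.ofReal_zero]
      exact oddMass_nonpos V (by linarith)
  simp_rw [h3]
  rw [← ofReal_integral_eq_lintegral_ofReal h1.pos_part (ae_of_all _ fun y => le_max_right _ _), ← h2]
  exact ENNReal.ofReal_le_ofReal (integral_mono h1 h1.pos_part fun y => le_max_left _ _)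

/-- The mean of `oddMass`, taken at the variance still to come, does not decrease along the killed
walk and finally is at most the survival probability. It starts from a first step below `-c 0`. -/
lemma le_walkNeg (c : ℕ → ℝ) (hc0 : 0 < c 0) (n : ℕ) {V : ℝ≥0}
    (hV : (V : ℝ) = ∑ i ∈ Finset.range n, c (i + 1) ^ 2) :
    gaussianReal 0 1 (Set.Iio (-1)) * ENNReal.ofReal (oddMass V (c 0)) ≤
      stdSeq (walkNeg c (n + 1)) := by
  set h : ℝ≥0 → ℝ → ℝ≥0∞ := fun V w => ENNReal.ofReal (oddMass V (-w))
  have hm : ∀ V, Measurable (h V) := fun V =>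
    ((oddMass_mono V).measurable.comp measurable_neg).ennreal_ofReal
  have key : ∀ k ≤ n, ∀ V' : ℝ≥0, (V' : ℝ) = ∑ i ∈ Finset.Ico k n, c (i + 1) ^ 2 →
      ∫⁻ x in walkNeg c 1, h V (walk c 1 x) ∂stdSeq ≤
      ∫⁻ x in walkNeg c (k + 1), h V' (walk c (k + 1) x) ∂stdSeq := by
    intro k
    induction k with
    | zero =>
      intro _ V' hV'
      have : V = V' := NNReal.coe_injective (by rw [hV, hV', Finset.range_eq_Ico])
      rw [this]
    | succ k ih =>
      intro hk V' hV'
      refine (ih (by omega) (V' + NNReal.mk (c (k + 1) ^ 2) (sq_nonneg _)) ?_).trans ?_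
      · rw [Finset.sum_eq_sum_Ico_succ_bot (by omega), ← hV', NNReal.coe_add, add_comm]
        rfl
      · rw [lintegral_walkNeg_succ c (k + 1) (hm _)]
        exact lintegral_mono fun x => lintegral_oddMass_le V' (c (k + 1)) _
  have h1 := key n le_rfl 0 (by simp)
  have h2 : ∫⁻ x in walkNeg c (n + 1), h 0 (walk c (n + 1) x) ∂stdSeq ≤
      stdSeq (walkNeg c (n + 1)) := by
    calc _ ≤ ∫⁻ x in walkNeg c (n + 1), 1 ∂stdSeq := lintegral_mono fun x => by
          simpa [h] using oddMass_le_one 0 _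
      _ = _ := by simp
  refine le_trans ?_ (h1.trans h2)
  rw [show (1 : ℕ) = 0 + 1 from rfl, lintegral_walkNeg_succ c 0 (hm _), walkNeg_zero]
  simp only [Measure.restrict_univ, walk_zero, lintegral_const, measure_univ, mul_one, zero_add]
  rw [mul_comm, ← setLIntegral_const, ← lintegral_indicator measurableSet_Iio]
  refine lintegral_mono fun y => ?_
  by_cases hy : y < -1
  · have hy' : c 0 * y < -c 0 := by nlinarith
    rw [Set.indicator_of_mem (Set.mem_Iio.2 hy), Set.indicator_of_mem (Set.mem_Iio.2 (by linarith))]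
    exact ENNReal.ofReal_le_ofReal (oddMass_mono V (by linarith))
  · rw [Set.indicator_of_notMem (by simpa using hy)]
    exact zero_le

end WalkLower
end WeightedPersistence

namespace WeightedPersistence
open scoped ENNReal NNReal RealInnerProductSpace Matrix

/-! ### Domination of nearly isotropic Gaussian measures by the standard one. -/

section DensityComparison

lemma gaussianReal_le_smul {a v : ℝ} (ha : 0 < a) (hav : a ≤ v) (hv : v ≤ 1) :
    gaussianReal 0 v.toNNReal ≤ (ENNReal.ofReal (√a)⁻¹) • gaussianReal 0 1 := by
  have hv0 : 0 < v := ha.trans_le hav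
  rw [gaussianReal_of_var_ne_zero _ (by simpa using hv0), gaussianReal_of_var_ne_zero _ one_ne_zero,
    ← withDensity_smul _ (measurable_gaussianPDF _ _)]
  refine withDensity_mono (ae_of_all _ fun x => ?_)
  simp only [Pi.smul_apply, smul_eq_mul, gaussianPDF]
  rw [← ENNReal.ofReal_mul (by positivity)]
  refine ENNReal.ofReal_le_ofReal ?_
  simp only [gaussianPDFReal, Real.coe_toNNReal _ hv0.le, NNReal.coe_one, mul_one, sub_zero]
  rw [Real.sqrt_mul (by positivity), mul_inv, ← mul_assoc, mul_comm (√a)⁻¹]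
  have hexp : Real.exp (-x ^ 2 / (2 * v)) ≤ Real.exp (-x ^ 2 / 2) := by
    refine Real.exp_le_exp.2 ?_
    rw [neg_div, neg_div, neg_le_neg_iff]
    exact div_le_div_of_nonneg_left (sq_nonneg x) (by positivity) (by linarith)
  grw [hexp, hav]

/-- The product outer measure is the largest one with given bounds on boxes, so comparison on boxes
suffices. -/
lemma pi_apply_le_of_le_smul {ι : Type*} [Fintype ι] {μ : ι → Measure ℝ} {ν : Measure ℝ}
    [∀ i, IsProbabilityMeasure (μ i)] [IsProbabilityMeasure ν] {c : ℝ≥0}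
    (h : ∀ i, μ i ≤ (c : ℝ≥0∞) • ν) {A : Set (ι → ℝ)} (hA : MeasurableSet A) :
    Measure.pi μ A ≤ (c : ℝ≥0∞) ^ Fintype.card ι * Measure.pi (fun _ => ν) A := by
  have h1 : Measure.pi (fun _ : ι => c • ν) = (c : ℝ≥0∞) ^ Fintype.card ι • Measure.pi fun _ => ν := by
    refine (Measure.pi_eq fun s _ => ?_)
    rw [Measure.smul_apply, Measure.pi_pi, smul_eq_mul, ← Finset.card_univ, ← Finset.prod_const,
      ← Finset.prod_mul_distrib]
    rfl
  have h2 : (Measure.pi μ).toOuterMeasure ≤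
      OuterMeasure.pi fun i : ι => (c • ν).toOuterMeasure := by
    rw [OuterMeasure.le_pi]
    intro s _
    change Measure.pi μ _ ≤ _
    rw [Measure.pi_pi]
    exact Finset.prod_le_prod' fun i _ => h i (s i)
  have h3 := h2 A
  rw [← smul_eq_mul, ← Measure.smul_apply, ← h1, Measure.pi_def (fun _ : ι => c • ν),
    toMeasure_apply _ _ hA]
  exact h3

variable {ι : Type*} [Fintype ι] [DecidableEq ι]

lemma multivariateGaussian_eq_map_pi {R : Matrix ι ι ℝ} (hR : R.PosSemidef) :
    multivariateGaussian 0 R =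
      (Measure.pi fun i => gaussianReal 0 (hR.isHermitian.eigenvalues i).toNNReal).map
        (fun x => ∑ i, x i • hR.isHermitian.eigenvectorBasis i) := by
  set b := hR.isHermitian.eigenvectorBasis
  set l := hR.isHermitian.eigenvalues
  have hmeas : Measurable (fun x : ι → ℝ => ∑ i, x i • b i) := by fun_prop
  have := Measure.isProbabilityMeasure_map hmeas.aemeasurable
    (μ := Measure.pi fun i => gaussianReal 0 (l i).toNNReal)
  apply Measure.ext_of_charFun
  ext t
  rw [charFun_multivariateGaussian hR, charFun_apply, integral_map hmeas.aemeasurable (by fun_prop)]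
  simp_rw [sum_inner, Complex.ofReal_sum, Finset.sum_mul, Complex.exp_sum,
    integral_fintype_prod_eq_prod (f := fun i (x : ℝ) ↦ Complex.exp (⟪x • b i, t⟫ * Complex.I)),
    real_inner_smul_left, mul_comm _ (⟪_, _⟫), Complex.ofReal_mul, ← charFun_apply_real,
    charFun_gaussianReal, ← Complex.exp_sum]
  congr 1
  have hquad : t.ofLp ⬝ᵥ R *ᵥ t.ofLp = ∑ i, l i * ⟪b i, t⟫ ^ 2 := by
    have h1 : t.ofLp = ∑ i, ⟪b i, t⟫ • (b i).ofLp := by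
      conv_lhs => rw [← b.sum_repr' t]
      simp
    have h2 : R *ᵥ t.ofLp = ∑ i, (⟪b i, t⟫ * l i) • (b i).ofLp := by
      conv_lhs => rw [h1]
      rw [Matrix.mulVec_sum]
      refine Finset.sum_congr rfl fun i _ => ?_
      rw [Matrix.mulVec_smul, hR.isHermitian.mulVec_eigenvectorBasis, smul_smul]
    rw [h2, dotProduct_sum]
    refine Finset.sum_congr rfl fun i _ => ?_
    have h3 : t.ofLp ⬝ᵥ (b i).ofLp = ⟪b i, t⟫ := by
      simp [PiLp.inner_apply, dotProduct]
    rw [dotProduct_smul, h3, smul_eq_mul]; ring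
  rw [hquad]
  simp only [inner_zero_right, Complex.ofReal_zero, mul_zero, zero_mul, zero_sub]
  push_cast
  rw [Finset.sum_div, ← Finset.sum_neg_distrib]
  refine Finset.sum_congr rfl fun i _ => ?_
  rw [Real.coe_toNNReal _ (hR.eigenvalues_nonneg i)]

/-- A Gaussian measure whose covariance matrix lies between `a` and `1` is dominated by the
standard Gaussian measure. -/
lemma multivariateGaussian_apply_le {R : Matrix ι ι ℝ} (hR : R.PosSemidef) {a : ℝ} (ha : 0 < a)
    (hlow : (R - a • (1 : Matrix ι ι ℝ)).PosSemidef)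
    (hupp : ((1 : Matrix ι ι ℝ) - R).PosSemidef) {A : Set (EuclideanSpace ℝ ι)}
    (hA : MeasurableSet A) :
    multivariateGaussian 0 R A ≤
      ENNReal.ofReal (√a)⁻¹ ^ Fintype.card ι * stdGaussian (EuclideanSpace ℝ ι) A := by
  set b := hR.isHermitian.eigenvectorBasis
  set l := hR.isHermitian.eigenvalues
  have hmeas : Measurable (fun x : ι → ℝ => ∑ i, x i • b i) := by fun_prop
  have hn : ∀ i, (b i).ofLp ⬝ᵥ (b i).ofLp = 1 := fun i => by
    have h3 : (b i).ofLp ⬝ᵥ (b i).ofLp = ‖b i‖ ^ 2 := by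
      rw [EuclideanSpace.real_norm_sq_eq]; simp [dotProduct, sq]
    rw [h3, b.orthonormal.1 i, one_pow]
  have hq : ∀ i, (b i).ofLp ⬝ᵥ R *ᵥ (b i).ofLp = l i := fun i => by
    rw [hR.isHermitian.mulVec_eigenvectorBasis, dotProduct_smul]
    change l i • ((b i).ofLp ⬝ᵥ (b i).ofLp) = l i
    rw [hn]; simp
  -- Testing the two semidefinite bounds on unit eigenvectors confines the eigenvalues to `[a, 1]`.
  have hal : ∀ i, a ≤ l i := fun i => by
    have := hlow.dotProduct_mulVec_nonneg (b i).ofLp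
    rw [Matrix.sub_mulVec, Matrix.smul_mulVec, Matrix.one_mulVec, star_trivial, dotProduct_sub,
      dotProduct_smul, hq, hn] at this
    simpa using this
  have hl1 : ∀ i, l i ≤ 1 := fun i => by
    have := hupp.dotProduct_mulVec_nonneg (b i).ofLp
    rw [Matrix.sub_mulVec, Matrix.one_mulVec, star_trivial, dotProduct_sub, hq, hn] at this
    simpa using this
  rw [multivariateGaussian_eq_map_pi hR, stdGaussian_eq_map_pi_orthonormalBasis b,
    Measure.map_apply hmeas hA, Measure.map_apply hmeas hA]
  exact pi_apply_le_of_le_smul (c := (√a)⁻¹.toNNReal)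
    (fun i => gaussianReal_le_smul ha (hal i) (hl1 i)) (hmeas hA)

/-- A matrix with nonnegative entries that is at most the identity and has almost unit diagonal
is almost at least the identity. -/
lemma sub_smul_one_posSemidef {R : Matrix ι ι ℝ} (hsymm : ∀ i j, R i j = R j i)
    (hnn : ∀ i j, 0 ≤ R i j) {e : ℝ} (hdiag : ∀ i, 1 - e ≤ R i i)
    (hupp : ∀ x : ι → ℝ, ∑ i, ∑ j, x i * x j * R i j ≤ ∑ i, x i ^ 2) :
    (R - (1 - 2 * e) • (1 : Matrix ι ι ℝ)).PosSemidef := by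
  refine posSemidef_of_forall (fun i j => ?_) fun x => ?_
  · simp [Matrix.one_apply, hsymm i j, eq_comm]
  · have h1 := hupp fun i => |x i|
    have h2 : ∀ i j, 2 * (if i = j then x i * x j * R i j else 0) - |x i| * |x j| * R i j ≤
        x i * x j * R i j := by
      intro i j
      split_ifs with hij
      · subst hij; rw [abs_mul_abs_self]; linarith
      · have : -(|x i| * |x j|) ≤ x i * x j := by rw [← abs_mul]; exact neg_abs_le _
        nlinarith [mul_le_mul_of_nonneg_right this (hnn i j)]
    have h3 : ∑ i, ∑ j, (2 * (if i = j then x i * x j * R i j else 0) - |x i| * |x j| * R i j) ≤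
        ∑ i, ∑ j, x i * x j * R i j :=
      Finset.sum_le_sum fun i _ => Finset.sum_le_sum fun j _ => h2 i j
    simp only [Finset.sum_sub_distrib, ← Finset.mul_sum, Finset.sum_ite_eq, Finset.mem_univ,
      if_true, sq_abs] at h3 h1
    have h4 : (1 - e) * ∑ i, x i ^ 2 ≤ ∑ i, x i * x i * R i i := by
      rw [Finset.mul_sum]
      refine Finset.sum_le_sum fun i _ => ?_
      nlinarith [mul_le_mul_of_nonneg_right (hdiag i) (mul_self_nonneg (x i))]
    have h5 : ∑ i, ∑ j, x i * x j * (R - (1 - 2 * e) • (1 : Matrix ι ι ℝ)) i j =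
        ∑ i, ∑ j, x i * x j * R i j - (1 - 2 * e) * ∑ i, x i ^ 2 := by
      rw [Finset.mul_sum, ← Finset.sum_sub_distrib]
      refine Finset.sum_congr rfl fun i _ => ?_
      simp only [Matrix.sub_apply, Matrix.smul_apply, Matrix.one_apply, smul_eq_mul, mul_sub,
        Finset.sum_sub_distrib, mul_ite, mul_one, mul_zero, Finset.sum_ite_eq, Finset.mem_univ,
        if_true]
      ring
    rw [h5]
    linarith

end DensityComparison
end WeightedPersistence

namespace WeightedPersistence
open scoped ENNReal NNReal

/-! ### Finite linear combinations of a Gaussian process. -/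

section LinearCombinations

variable {Ω : Type*} [MeasurableSpace Ω] {P : Measure Ω} {ξ : ℕ → Ω → ℝ}
  {ι : Type*} [Fintype ι]

lemma hasGaussianLaw_sum_mul (hξ : IsGaussianProcess ξ P) (s : ι → Finset ℕ) (a : ι → ℕ → ℝ) :
    HasGaussianLaw (fun ω l => ∑ i ∈ s l, a l i * ξ i ω) P := by
  set s₀ : Finset ℕ := Finset.univ.biUnion s
  set L : (s₀ → ℝ) →L[ℝ] (ι → ℝ) := ContinuousLinearMap.pi fun l =>
    ∑ i : s₀, (if (i : ℕ) ∈ s l then a l i else 0) • ContinuousLinearMap.proj i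
  have h := (hξ.hasGaussianLaw s₀).map_fun L
  refine h.congr (ae_of_all _ fun ω => ?_)
  ext l
  simp only [L, ContinuousLinearMap.coe_pi', sum_apply,
    smul_apply, ContinuousLinearMap.proj_apply, Finset.restrict, smul_eq_mul]
  rw [Finset.sum_coe_sort s₀ fun i => (if i ∈ s l then a l i else 0) * ξ i ω]
  simp only [ite_mul, zero_mul]
  rw [← Finset.sum_filter]
  refine Finset.sum_congr ?_ fun _ _ => rfl
  ext i
  simp only [s₀, Finset.mem_filter, Finset.mem_biUnion, Finset.mem_univ, true_and]
  exact ⟨fun h => h.2, fun h => ⟨⟨l, h⟩, h⟩⟩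

lemma integral_sum_mul_sum_mul (hξ : IsGaussianProcess ξ P) (s t : Finset ℕ) (a b : ℕ → ℝ) :
    ∫ ω, (∑ i ∈ s, a i * ξ i ω) * (∑ j ∈ t, b j * ξ j ω) ∂P =
      ∑ i ∈ s, ∑ j ∈ t, a i * b j * ∫ ω, ξ i ω * ξ j ω ∂P := by
  have hL : ∀ i, MemLp (ξ i) 2 P := fun i => (hξ.hasGaussianLaw_eval i).memLp_two
  have hint : ∀ i j, Integrable (fun ω => a i * ξ i ω * (b j * ξ j ω)) P := fun i j =>
    (((hL i).integrable_mul (hL j)).const_mul (a i * b j)).congr (ae_of_all _ fun ω => by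
      simp; ring)
  simp_rw [Finset.sum_mul_sum]
  rw [integral_finsetSum _ fun i _ => integrable_finsetSum _ fun j _ => hint i j]
  refine Finset.sum_congr rfl fun i _ => ?_
  rw [integral_finsetSum _ fun j _ => hint i j]
  refine Finset.sum_congr rfl fun j _ => ?_
  rw [← integral_const_mul]
  congr 1; ext ω; ring

/-- Linear combinations of a centred Gaussian process are distributed according to their
covariance matrix. -/
lemma map_sum_mul_eq_multivariateGaussian [DecidableEq ι] (hξ : IsGaussianProcess ξ P)
    (hmean : ∀ i, ∫ ω, ξ i ω ∂P = 0) (s : ι → Finset ℕ) (a : ι → ℕ → ℝ) {R : Matrix ι ι ℝ}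
    (hR : ∀ k l, R k l = ∑ i ∈ s k, ∑ j ∈ s l, a k i * a l j * ∫ ω, ξ i ω * ξ j ω ∂P) :
    R.PosSemidef ∧ P.map (fun ω => WithLp.toLp 2 fun l => ∑ i ∈ s l, a l i * ξ i ω) =
      multivariateGaussian 0 R := by
  have hG := hasGaussianLaw_sum_mul hξ s a
  have h2 : ∀ k l, ∫ ω, (∑ i ∈ s k, a k i * ξ i ω) * (∑ j ∈ s l, a l j * ξ j ω) ∂P = R k l :=
    fun k l => by rw [integral_sum_mul_sum_mul hξ, hR]
  refine ⟨posSemidef_of_integral_mul hG h2, map_eq_multivariateGaussian hG (fun l => ?_) h2⟩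
  rw [integral_finsetSum _ fun i _ => ((hξ.hasGaussianLaw_eval i).integrable.const_mul _)]
  simp [integral_const_mul, hmean]

lemma measure_sum_mul_lt_eq_orthantProb [DecidableEq ι] (hξ : IsGaussianProcess ξ P)
    (hmean : ∀ i, ∫ ω, ξ i ω ∂P = 0) (s : ι → Finset ℕ) (a : ι → ℕ → ℝ) (b : ι → ℝ)
    {R : Matrix ι ι ℝ}
    (hR : ∀ k l, R k l = ∑ i ∈ s k, ∑ j ∈ s l, a k i * a l j * ∫ ω, ξ i ω * ξ j ω ∂P) :
    P {ω | ∀ l, ∑ i ∈ s l, a l i * ξ i ω < b l} = orthantProb b R := by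
  rw [orthantProb, ← (map_sum_mul_eq_multivariateGaussian hξ hmean s a hR).2,
    Measure.map_apply_of_aemeasurable _ (measurableSet_orthant b)]
  · rfl
  · exact ((hasGaussianLaw_sum_mul hξ s a).toLp_pi 2).aemeasurable

lemma isGaussianProcess_stdSeq : IsGaussianProcess (fun i (x : ℕ → ℝ) => x i) stdSeq := by
  refine ⟨fun I => ?_⟩
  have hind : iIndepFun (fun (i : ℕ) (x : ℕ → ℝ) => x i) stdSeq :=
    iIndepFun_infinitePi (X := fun _ x => x) (by fun_prop)
  have hlaw : ∀ i : ℕ, HasGaussianLaw (fun x : ℕ → ℝ => x i) stdSeq := fun i => by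
    refine ⟨?_⟩
    have : stdSeq.map (fun x => x i) = gaussianReal 0 1 := Measure.infinitePi_map_eval _ i
    rw [this]; infer_instance
  exact (hind.precomp (g := fun i : I => (i : ℕ)) Subtype.val_injective).hasGaussianLaw
    fun i => hlaw i

lemma integral_stdSeq (i : ℕ) : ∫ x, x i ∂stdSeq = 0 := by
  have h : stdSeq.map (fun x => x i) = gaussianReal 0 1 := Measure.infinitePi_map_eval _ i
  have h2 := integral_id_gaussianReal (μ := 0) (v := 1)
  rw [← h, integral_map (measurable_pi_apply i).aemeasurable (by fun_prop)] at h2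
  exact h2

lemma integral_mul_stdSeq (i j : ℕ) : ∫ x, x i * x j ∂stdSeq = if i = j then 1 else 0 := by
  split_ifs with hij
  · subst hij
    have h : stdSeq.map (fun x => x i) = gaussianReal 0 1 := Measure.infinitePi_map_eval _ i
    have h2 : ∫ y, y * y ∂gaussianReal 0 1 = 1 := by
      have := variance_id_gaussianReal (μ := 0) (v := 1)
      rw [variance_eq_integral (by fun_prop)] at this
      simpa [sq] using this
    rw [← h, integral_map (measurable_pi_apply i).aemeasurable (by fun_prop)] at h2
    exact h2
  · have hind : iIndepFun (fun (i : ℕ) (x : ℕ → ℝ) => x i) stdSeq :=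
      iIndepFun_infinitePi (X := fun _ x => x) (by fun_prop)
    rw [(hind.indepFun hij).integral_fun_mul_eq_mul_integral
      (measurable_pi_apply i).aestronglyMeasurable (measurable_pi_apply j).aestronglyMeasurable,
      integral_stdSeq, zero_mul]

lemma stdSeq_walkNeg_eq_orthantProb (c : ℕ → ℝ) (n : ℕ) :
    stdSeq (walkNeg c n) = orthantProb (fun _ : Fin n => 0)
      (fun k l => ∑ i ∈ Finset.range (min (k + 1) (l + 1)), c i ^ 2) := by
  -- The index `l : Fin n` stands for the time `l + 1`.
  have h1 : walkNeg c n = {x | ∀ l : Fin n, ∑ i ∈ Finset.range (l + 1), c i * x i < 0} := by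
    ext x
    simp only [walkNeg, walk, Set.mem_ofPred_eq, Finset.mem_Icc]
    constructor
    · intro h l; exact h (l + 1) ⟨by omega, by omega⟩
    · rintro h l ⟨hl1, hl2⟩
      have := h ⟨l - 1, by omega⟩
      simpa [Nat.sub_add_cancel hl1] using this
  rw [h1]
  refine measure_sum_mul_lt_eq_orthantProb isGaussianProcess_stdSeq integral_stdSeq
    (fun l : Fin n => Finset.range (l + 1)) (fun _ => c) (fun _ => 0) fun k l => ?_
  simp only [integral_mul_stdSeq, mul_ite, mul_one, mul_zero, Finset.sum_ite_eq, Finset.mem_range]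
  rw [← Finset.sum_filter]
  refine Finset.sum_congr ?_ fun i _ => by ring
  ext i; simp

lemma map_stdSeq_eq_stdGaussian (n : ℕ) :
    stdSeq.map (fun x => WithLp.toLp 2 fun l : Fin n => x l) =
      stdGaussian (EuclideanSpace ℝ (Fin n)) := by
  rw [← multivariateGaussian_zero_one]
  have := (map_sum_mul_eq_multivariateGaussian isGaussianProcess_stdSeq integral_stdSeq
    (fun l : Fin n => {(l : ℕ)}) (fun _ _ => 1) (R := 1) fun k l => ?_).2
  · simpa using this
  · simp [integral_mul_stdSeq, Matrix.one_apply, Fin.ext_iff, eq_comm]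

end LinearCombinations

/-! ### Comparison from below with an independent walk. -/

section Lower

variable {Ω : Type*} [MeasurableSpace Ω] {P : Measure Ω}
  {ξ : ℕ → Ω → ℝ}

/-- With truncated subtraction, `(i - j) + (j - i)` is the distance `|i - j|`. -/
lemma integral_mul_eq_corr (hstat : IsStationary ξ P) (i j : ℕ) :
    ∫ ω, ξ i ω * ξ j ω ∂P = corr ξ P ((i - j) + (j - i)) := by
  have key : ∀ i k : ℕ, ∫ ω, ξ i ω * ξ (i + k) ω ∂P = corr ξ P k := by
    intro i k
    have := (hstat i).comp (u := fun x : ℕ → ℝ => x 0 * x k) (by fun_prop)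
    have h2 := this.integral_eq
    simp only [Function.comp_def, zero_add] at h2
    rw [corr, ← h2, add_comm k i]
  rcases le_total i j with h | h
  · have := key i (j - i)
    rw [Nat.add_sub_cancel' h] at this
    rw [this, Nat.sub_eq_zero_of_le h, zero_add]
  · have := key j (i - j)
    rw [Nat.add_sub_cancel' h] at this
    simp_rw [mul_comm (ξ i _)]
    rw [this, Nat.sub_eq_zero_of_le h, add_zero]

/-- The covariance of the weighted sums over `s` and `t`, for the correlation function `ρ`. -/
def blockCov (ρ σ : ℕ → ℝ) (s t : Finset ℕ) : ℝ :=
  ∑ i ∈ s, ∑ j ∈ t, σ i * σ j * ρ ((i - j) + (j - i))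

lemma blockCov_mono {ρ σ : ℕ → ℝ} (hρ : ∀ i, 0 ≤ ρ i) (hσ : ∀ i, 1 ≤ i → 0 < σ i)
    {s t s' t' : Finset ℕ} (hs : s ⊆ s') (ht : t ⊆ t') (hs' : ∀ i ∈ s', 1 ≤ i)
    (ht' : ∀ i ∈ t', 1 ≤ i) : blockCov ρ σ s t ≤ blockCov ρ σ s' t' := by
  have h0 : ∀ i ∈ s', ∀ j ∈ t', 0 ≤ σ i * σ j * ρ ((i - j) + (j - i)) := fun i hi j hj =>
    mul_nonneg (mul_nonneg (hσ i (hs' i hi)).le (hσ j (ht' j hj)).le) (hρ _)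
  calc blockCov ρ σ s t ≤ ∑ i ∈ s, ∑ j ∈ t', σ i * σ j * ρ ((i - j) + (j - i)) :=
        Finset.sum_le_sum fun i hi => Finset.sum_le_sum_of_subset_of_nonneg ht
          fun j hj _ => h0 i (hs hi) j hj
    _ ≤ _ := Finset.sum_le_sum_of_subset_of_nonneg hs fun i hi _ =>
        Finset.sum_nonneg fun j hj => h0 i hi j hj

/-- The new diagonal term contributes `σ (k + 1) ^ 2`, and all new cross terms are nonnegative. -/
lemma blockCov_succ_sub {ρ σ : ℕ → ℝ} (hρ : ∀ i, 0 ≤ ρ i) (hρ0 : ρ 0 = 1)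
    (hσ : ∀ i, 1 ≤ i → 0 < σ i) (k : ℕ) :
    σ (k + 1) ^ 2 ≤ blockCov ρ σ (Finset.Icc 1 (k + 1)) (Finset.Icc 1 (k + 1)) -
      blockCov ρ σ (Finset.Icc 1 k) (Finset.Icc 1 k) := by
  have h1 : blockCov ρ σ (Finset.Icc 1 (k + 1)) (Finset.Icc 1 (k + 1)) =
      blockCov ρ σ (Finset.Icc 1 k) (Finset.Icc 1 (k + 1)) +
        ∑ j ∈ Finset.Icc 1 (k + 1), σ (k + 1) * σ j * ρ ((k + 1 - j) + (j - (k + 1))) := by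
    rw [blockCov, Finset.sum_Icc_succ_top (by omega)]; rfl
  have h2 : blockCov ρ σ (Finset.Icc 1 k) (Finset.Icc 1 k) ≤
      blockCov ρ σ (Finset.Icc 1 k) (Finset.Icc 1 (k + 1)) :=
    blockCov_mono hρ hσ subset_rfl (Finset.Icc_subset_Icc_right (by omega))
      (fun i hi => (Finset.mem_Icc.1 hi).1) (fun i hi => (Finset.mem_Icc.1 hi).1)
  have h3 : σ (k + 1) * σ (k + 1) * ρ ((k + 1 - (k + 1)) + (k + 1 - (k + 1))) ≤
      ∑ j ∈ Finset.Icc 1 (k + 1), σ (k + 1) * σ j * ρ ((k + 1 - j) + (j - (k + 1))) :=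
    Finset.single_le_sum (f := fun j => σ (k + 1) * σ j * ρ ((k + 1 - j) + (j - (k + 1))))
      (fun j hj => mul_nonneg (mul_nonneg (hσ _ (by omega)).le
        (hσ j (Finset.mem_Icc.1 hj).1).le) (hρ _)) (Finset.mem_Icc.2 ⟨by omega, le_rfl⟩)
  rw [Nat.sub_self, add_zero, hρ0] at h3
  nlinarith

lemma persistenceProb_eq_orthantProb (hgauss : IsGaussianProcess ξ P)
    (hcentered : ∀ i, ∫ ω, ξ i ω ∂P = 0) (hstat : IsStationary ξ P) (σ : ℕ → ℝ) (n : ℕ) :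
    persistenceProb σ ξ P n = (orthantProb (fun _ : Fin n => 0) fun k l =>
      blockCov (corr ξ P) σ (Finset.Icc 1 (k + 1)) (Finset.Icc 1 (l + 1))).toReal := by
  rw [persistenceProb, measureReal_def]
  congr 1
  have h1 : {ω | ∀ l ∈ Finset.Icc 1 n, partialSum σ ξ l ω < 0} =
      {ω | ∀ l : Fin n, ∑ i ∈ Finset.Icc 1 ((l : ℕ) + 1), σ i * ξ i ω < 0} := by
    ext ω
    simp only [partialSum, Set.mem_ofPred_eq, Finset.mem_Icc]
    constructor
    · intro h l; exact h (l + 1) ⟨by omega, by omega⟩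
    · rintro h l ⟨hl1, hl2⟩
      have := h ⟨l - 1, by omega⟩
      simpa [Nat.sub_add_cancel hl1] using this
  rw [h1]
  refine measure_sum_mul_lt_eq_orthantProb hgauss hcentered
    (fun l : Fin n => Finset.Icc 1 ((l : ℕ) + 1)) (fun _ => σ) (fun _ => 0) fun k l => ?_
  simp_rw [integral_mul_eq_corr hstat]
  rfl

/-- By Slepian's inequality, the weighted sums are at least as persistent as the walk with
independent increments and the same variances. -/
lemma stdSeq_walkNeg_le_persistenceProb (hgauss : IsGaussianProcess ξ P)
    (hcentered : ∀ i, ∫ ω, ξ i ω ∂P = 0) (hstat : IsStationary ξ P)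
    (hρ : ∀ i, 0 ≤ corr ξ P i) (hρ0 : corr ξ P 0 = 1) {σ : ℕ → ℝ} (hσ : ∀ i, 1 ≤ i → 0 < σ i)
    {c : ℕ → ℝ} (hc : ∀ k, c k ^ 2 =
      blockCov (corr ξ P) σ (Finset.Icc 1 (k + 1)) (Finset.Icc 1 (k + 1)) -
      blockCov (corr ξ P) σ (Finset.Icc 1 k) (Finset.Icc 1 k)) (n : ℕ) :
    stdSeq.real (walkNeg c n) ≤ persistenceProb σ ξ P n := by
  have hsum : ∀ k, ∑ i ∈ Finset.range k, c i ^ 2 =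
      blockCov (corr ξ P) σ (Finset.Icc 1 k) (Finset.Icc 1 k) := fun k => by
    simp_rw [hc]
    rw [Finset.sum_range_sub fun k => blockCov (corr ξ P) σ (Finset.Icc 1 k) (Finset.Icc 1 k)]
    simp [blockCov]
  rw [persistenceProb_eq_orthantProb hgauss hcentered hstat, measureReal_def,
    stdSeq_walkNeg_eq_orthantProb]
  refine ENNReal.toReal_mono (measure_ne_top (multivariateGaussian 0 _) _) ?_
  have hpos : ∀ i, 0 < c i ^ 2 := fun i => by
    rw [hc]
    exact (pow_pos (hσ (i + 1) (by omega)) 2).trans_le (blockCov_succ_sub hρ hρ0 hσ i)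
  refine orthantProb_mono _ ?_ ?_ (fun i => ?_) (fun i => ?_) fun i j => ?_
  · refine (map_sum_mul_eq_multivariateGaussian isGaussianProcess_stdSeq integral_stdSeq
      (fun l : Fin n => Finset.range (l + 1)) (fun _ => c) fun k l => ?_).1
    simp only [integral_mul_stdSeq, mul_ite, mul_one, mul_zero, Finset.sum_ite_eq,
      Finset.mem_range]
    rw [← Finset.sum_filter]
    refine Finset.sum_congr ?_ fun i _ => by ring
    ext i; simp
  · refine (map_sum_mul_eq_multivariateGaussian hgauss hcentered
      (fun l : Fin n => Finset.Icc 1 ((l : ℕ) + 1)) (fun _ => σ) fun k l => ?_).1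
    simp_rw [integral_mul_eq_corr hstat]
    rfl
  · exact Finset.sum_pos (fun i _ => hpos i) ⟨0, by simp⟩
  · simp only [min_self]; exact hsum _
  · rw [hsum]
    exact blockCov_mono hρ hσ (Finset.Icc_subset_Icc_right (min_le_left _ _))
      (Finset.Icc_subset_Icc_right (min_le_right _ _))
      (fun i hi => (Finset.mem_Icc.1 hi).1) (fun i hi => (Finset.mem_Icc.1 hi).1)

end Lower
end WeightedPersistence

namespace WeightedPersistence
open scoped ENNReal NNReal

/-! ### Asymptotics of block variances. -/

section Covariance

/-- The limiting variance `∑_{k ∈ ℤ} ρ(|k|)` per unit of squared weight (for `ρ 0 = 1`). -/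
noncomputable def totalCorr (ρ : ℕ → ℝ) : ℝ := 2 * ∑' k, ρ k - 1

variable {ρ σ : ℕ → ℝ}

lemma one_le_totalCorr (hρ : ∀ i, 0 ≤ ρ i) (hsum : Summable ρ) (hρ0 : ρ 0 = 1) :
    1 ≤ totalCorr ρ := by
  have := hsum.le_tsum 0 fun i _ => hρ i
  rw [totalCorr]; linarith

/-- Each distance from `i` occurs at most once on either side, and distance zero only once in all.
-/
lemma sum_corr_row_le (hρ : ∀ i, 0 ≤ ρ i) (hsum : Summable ρ) (hρ0 : ρ 0 = 1) (i : ℕ)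
    (s : Finset ℕ) : ∑ j ∈ s, ρ ((i - j) + (j - i)) ≤ totalCorr ρ := by
  rw [← Finset.sum_filter_add_sum_filter_not s (fun j => i ≤ j)]
  have h1 : ∑ j ∈ s with i ≤ j, ρ ((i - j) + (j - i)) ≤ ∑' k, ρ k := by
    rw [← Finset.sum_image (g := fun j => (i - j) + (j - i)) (f := ρ)]
    · exact hsum.sum_le_tsum _ fun k _ => hρ k
    · intro a ha b hb hab
      simp only [Finset.coe_filter, Set.mem_ofPred_eq] at ha hb hab
      omega
  have h2 : ∑ j ∈ s with ¬ i ≤ j, ρ ((i - j) + (j - i)) + ρ 0 ≤ ∑' k, ρ k := by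
    rw [← Finset.sum_image (g := fun j => (i - j) + (j - i)) (f := ρ), add_comm,
      ← Finset.sum_insert]
    · exact hsum.sum_le_tsum _ fun k _ => hρ k
    · simp only [Finset.mem_image, Finset.mem_filter, not_exists, not_and]
      intro a ha; omega
    · intro a ha b hb hab
      simp only [Finset.coe_filter, Set.mem_ofPred_eq] at ha hb hab
      omega
  rw [totalCorr]; linarith

/-- **Schur's test** for a symmetric kernel with nonnegative entries. -/
lemma sum_sum_mul_le_of_row_le {α : Type*} (D : Finset α) {r : α → α → ℝ} {K : ℝ}
    (hsymm : ∀ p q, r p q = r q p) (hnn : ∀ p q, 0 ≤ r p q) (hrow : ∀ p ∈ D, ∑ q ∈ D, r p q ≤ K)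
    (b : α → ℝ) : ∑ p ∈ D, ∑ q ∈ D, b p * b q * r p q ≤ K * ∑ p ∈ D, b p ^ 2 := by
  have h1 : ∑ p ∈ D, ∑ q ∈ D, b p * b q * r p q ≤
      ∑ p ∈ D, ∑ q ∈ D, (b p ^ 2 * r p q / 2 + b q ^ 2 * r p q / 2) := by
    refine Finset.sum_le_sum fun p _ => Finset.sum_le_sum fun q _ => ?_
    nlinarith [mul_nonneg (hnn p q) (sq_nonneg (b p - b q))]
  have h2 : ∑ p ∈ D, ∑ q ∈ D, b q ^ 2 * r p q / 2 = ∑ p ∈ D, ∑ q ∈ D, b p ^ 2 * r p q / 2 := by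
    rw [Finset.sum_comm]
    exact Finset.sum_congr rfl fun p _ => Finset.sum_congr rfl fun q _ => by rw [hsymm]
  simp only [Finset.sum_add_distrib, h2] at h1
  refine h1.trans ?_
  rw [← Finset.sum_add_distrib, Finset.mul_sum]
  refine Finset.sum_le_sum fun p hp => ?_
  rw [← Finset.sum_div, ← Finset.mul_sum]
  nlinarith [mul_le_mul_of_nonneg_left (hrow p hp) (sq_nonneg (b p))]

lemma blockCov_self_le (hρ : ∀ i, 0 ≤ ρ i) (hsum : Summable ρ) (hρ0 : ρ 0 = 1) (s : Finset ℕ) :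
    blockCov ρ σ s s ≤ totalCorr ρ * ∑ i ∈ s, σ i ^ 2 :=
  sum_sum_mul_le_of_row_le s (r := fun i j => ρ ((i - j) + (j - i)))
    (fun i j => by rw [add_comm]) (fun i j => hρ _)
    (fun i _ => sum_corr_row_le hρ hsum hρ0 i s) σ

lemma scale_sq (σ : ℕ → ℝ) (n : ℕ) : scale σ n ^ 2 = ∑ i ∈ Finset.Icc 1 n, σ i ^ 2 :=
  Real.sq_sqrt (Finset.sum_nonneg fun _ _ => sq_nonneg _)

lemma scale_nonneg (σ : ℕ → ℝ) (n : ℕ) : 0 ≤ scale σ n := Real.sqrt_nonneg _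

lemma scale_sq_sub (σ : ℕ → ℝ) {l m : ℕ} (h : l ≤ m) :
    scale σ m ^ 2 - scale σ l ^ 2 = ∑ i ∈ Finset.Ioc l m, σ i ^ 2 := by
  have h1 : ∀ n, Finset.Icc 1 n = Finset.Ioc 0 n := fun n => by ext; simp; omega
  rw [scale_sq, scale_sq, h1, h1, ← Finset.sum_Ioc_consecutive _ (Nat.zero_le l) h]
  ring

lemma scale_mono (σ : ℕ → ℝ) : Monotone (scale σ) := fun l m h => by
  refine abs_le_of_sq_le_sq' ?_ (scale_nonneg _ _) |>.2
  have := scale_sq_sub σ h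
  have h2 : 0 ≤ ∑ i ∈ Finset.Ioc l m, σ i ^ 2 := Finset.sum_nonneg fun _ _ => sq_nonneg _
  linarith

lemma exists_weights_almost_constant (hσ : ∀ i, 1 ≤ i → 0 < σ i)
    (hratio : ∀ l : ℕ, 1 ≤ l → Tendsto (fun n => σ (n + l) / σ n) atTop (𝓝 1))
    {ε : ℝ} (hε : 0 < ε) (A : ℕ) :
    ∀ᶠ n in atTop, ∀ i ≥ n, ∀ k < A, (1 - ε) * σ i ≤ σ (i + k) ∧ (1 - ε) * σ (i + k) ≤ σ i := by
  have h1 : ∀ᶠ i in atTop, ∀ k ∈ Finset.range A,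
      (1 - ε) * σ i ≤ σ (i + k) ∧ (1 - ε) * σ (i + k) ≤ σ i := by
    rw [eventually_all_finset]
    intro k _
    rcases Nat.eq_zero_or_pos k with rfl | hk
    · filter_upwards [eventually_ge_atTop 1] with i hi
      have := hσ i hi
      simp only [add_zero, and_self]; nlinarith
    · have h2 := hratio k hk
      have h3 := h2.inv₀ one_ne_zero
      rw [inv_one] at h3
      filter_upwards [h2.eventually_const_lt (by linarith : 1 - ε < 1),
        h3.eventually_const_lt (by linarith : 1 - ε < 1), eventually_ge_atTop 1] with i h4 h5 hi
      rw [lt_div_iff₀ (hσ i hi)] at h4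
      rw [inv_div, lt_div_iff₀ (hσ _ (by omega))] at h5
      exact ⟨h4.le, h5.le⟩
  obtain ⟨N, hN⟩ := eventually_atTop.1 h1
  filter_upwards [eventually_ge_atTop N] with n hn i hi k hk
  exact hN i (hn.trans hi) k (Finset.mem_range.2 hk)

/-- Many weights up to index `i` are at least `σ i / 2`, so `σ i ^ 2` is a small share of the total;
`L > 4 / ε` of them suffice. -/
lemma eventually_weight_sq_le (hσ : ∀ i, 1 ≤ i → 0 < σ i)
    (hratio : ∀ l : ℕ, 1 ≤ l → Tendsto (fun n => σ (n + l) / σ n) atTop (𝓝 1))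
    {ε : ℝ} (hε : 0 < ε) : ∀ᶠ i in atTop, σ i ^ 2 ≤ ε * scale σ i ^ 2 := by
  obtain ⟨L, hL⟩ := exists_nat_gt (4 / ε)
  obtain ⟨N, hN⟩ := (exists_weights_almost_constant hσ hratio
    (by norm_num : (0 : ℝ) < 1 / 2) (L + 1)).exists
  filter_upwards [eventually_ge_atTop (N + L + 1)] with i hi
  have h1 := scale_sq_sub σ (Nat.sub_le i L)
  have h2 : ∑ j ∈ Finset.Ioc (i - L) i, σ i ^ 2 / 4 ≤ ∑ j ∈ Finset.Ioc (i - L) i, σ j ^ 2 := by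
    refine Finset.sum_le_sum fun j hj => ?_
    rw [Finset.mem_Ioc] at hj
    have h3 := (hN j (by omega) (i - j) (by omega)).2
    rw [Nat.add_sub_cancel' hj.2] at h3
    have h4 := hσ i (by omega)
    nlinarith
  rw [Finset.sum_const, Nat.card_Ioc, Nat.sub_sub_self (by omega), nsmul_eq_mul] at h2
  have h5 := sq_nonneg (scale σ (i - L))
  rw [div_lt_iff₀ hε] at hL
  have h6 : L * (σ i ^ 2 / 4) ≤ scale σ i ^ 2 := by linarith
  nlinarith [mul_le_mul_of_nonneg_left h6 hε.le, sq_nonneg (σ i)]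

/-- A row farther than `A` from both ends of the block sees all lags up to `A` on both sides, with
weights almost equal to `σ i`. -/
lemma le_sum_corr_row (hρ : ∀ i, 0 ≤ ρ i) (hρ0 : ρ 0 = 1) (hσ : ∀ i, 1 ≤ i → 0 < σ i)
    {A l m i : ℕ} {ε : ℝ} (hl : ∀ i ≥ l, ∀ k < A + 1,
      (1 - ε) * σ i ≤ σ (i + k) ∧ (1 - ε) * σ (i + k) ≤ σ i)
    (h1 : l + A < i) (h2 : i + A ≤ m) :
    (1 - ε) * (2 * ∑ k ∈ Finset.range (A + 1), ρ k - 1) * σ i ^ 2 ≤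
      ∑ j ∈ Finset.Ioc l m, σ i * σ j * ρ ((i - j) + (j - i)) := by
  have hi := hσ i (by omega)
  have hnn : ∀ j ∈ Finset.Ioc l m, 0 ≤ σ i * σ j * ρ ((i - j) + (j - i)) := fun j hj =>
    mul_nonneg (mul_nonneg hi.le (hσ j (by have := (Finset.mem_Ioc.1 hj).1; omega)).le) (hρ _)
  rw [← Finset.sum_filter_add_sum_filter_not (Finset.Ioc l m) (fun j => i ≤ j)]
  have h3 : (1 - ε) * (∑ k ∈ Finset.range (A + 1), ρ k) * σ i ^ 2 ≤
      ∑ j ∈ Finset.Ioc l m with i ≤ j, σ i * σ j * ρ ((i - j) + (j - i)) := by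
    calc _ ≤ ∑ k ∈ Finset.range (A + 1), σ i * σ (i + k) * ρ ((i - (i + k)) + (i + k - i)) := by
          rw [Finset.mul_sum, Finset.sum_mul]
          refine Finset.sum_le_sum fun k hk => ?_
          have h4 := (hl i (by omega) k (Finset.mem_range.1 hk)).1
          rw [Nat.sub_eq_zero_of_le (by omega), zero_add, Nat.add_sub_cancel_left]
          nlinarith [mul_le_mul_of_nonneg_left h4 (mul_nonneg hi.le (hρ k))]
      _ = ∑ j ∈ (Finset.range (A + 1)).image (fun k => i + k),
          σ i * σ j * ρ ((i - j) + (j - i)) := by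
          rw [Finset.sum_image]
          intro a _ b _ hab; simpa using hab
      _ ≤ _ := by
          refine Finset.sum_le_sum_of_subset_of_nonneg (fun j hj => ?_) fun j hj _ =>
            hnn j (Finset.mem_filter.1 hj).1
          simp only [Finset.mem_image, Finset.mem_range, Finset.mem_filter, Finset.mem_Ioc] at hj ⊢
          omega
  have h4 : (1 - ε) * (∑ k ∈ Finset.range A, ρ (k + 1)) * σ i ^ 2 ≤
      ∑ j ∈ Finset.Ioc l m with ¬ i ≤ j, σ i * σ j * ρ ((i - j) + (j - i)) := by
    calc _ ≤ ∑ k ∈ Finset.range A, σ i * σ (i - (k + 1)) *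
            ρ ((i - (i - (k + 1))) + (i - (k + 1) - i)) := by
          rw [Finset.mul_sum, Finset.sum_mul]
          refine Finset.sum_le_sum fun k hk => ?_
          have hk' := Finset.mem_range.1 hk
          have h4 := (hl (i - (k + 1)) (by omega) (k + 1) (by omega)).2
          rw [Nat.sub_add_cancel (by omega)] at h4
          rw [Nat.sub_sub_self (by omega), Nat.sub_eq_zero_of_le (Nat.sub_le _ _), add_zero]
          nlinarith [mul_le_mul_of_nonneg_left h4 (mul_nonneg hi.le (hρ (k + 1)))]
      _ = ∑ j ∈ (Finset.range A).image (fun k => i - (k + 1)),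
          σ i * σ j * ρ ((i - j) + (j - i)) := by
          rw [Finset.sum_image]
          intro a ha b hb hab
          simp only [Finset.coe_range, Set.mem_Iio] at ha hb hab
          omega
      _ ≤ _ := by
          refine Finset.sum_le_sum_of_subset_of_nonneg (fun j hj => ?_) fun j hj _ =>
            hnn j (Finset.mem_filter.1 hj).1
          simp only [Finset.mem_image, Finset.mem_range, Finset.mem_filter, Finset.mem_Ioc] at hj ⊢
          omega
  have h5 := Finset.sum_range_succ' ρ A
  rw [hρ0] at h5
  have h6 : ∑ k ∈ Finset.range A, ρ (k + 1) = ∑ k ∈ Finset.range (A + 1), ρ k - 1 := by linarith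
  rw [h6] at h4
  calc _ = (1 - ε) * (∑ k ∈ Finset.range (A + 1), ρ k) * σ i ^ 2 +
        (1 - ε) * (∑ k ∈ Finset.range (A + 1), ρ k - 1) * σ i ^ 2 := by ring
    _ ≤ _ := add_le_add h3 h4

/-- A late block carrying a fixed proportion of the total squared weight has variance asymptotic
to `totalCorr ρ` times its squared weight. -/
lemma eventually_le_blockCov (hρ : ∀ i, 0 ≤ ρ i) (hsum : Summable ρ) (hρ0 : ρ 0 = 1)
    (hσ : ∀ i, 1 ≤ i → 0 < σ i)
    (hratio : ∀ l : ℕ, 1 ≤ l → Tendsto (fun n => σ (n + l) / σ n) atTop (𝓝 1))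
    {e θ : ℝ} (he : 0 < e) (he1 : e ≤ 1) (hθ : 0 < θ) :
    ∀ᶠ l in atTop, ∀ m ≥ l, θ * scale σ m ^ 2 ≤ scale σ m ^ 2 - scale σ l ^ 2 →
      (1 - e) * (totalCorr ρ * (scale σ m ^ 2 - scale σ l ^ 2)) ≤
        blockCov ρ σ (Finset.Ioc l m) (Finset.Ioc l m) := by
  have hκ := one_le_totalCorr hρ hsum hρ0
  set κ := totalCorr ρ
  obtain ⟨A, hA⟩ : ∃ A : ℕ, (1 - e / 3) * κ ≤ 2 * ∑ k ∈ Finset.range (A + 1), ρ k - 1 := by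
    have h1 : Tendsto (fun A => 2 * ∑ k ∈ Finset.range (A + 1), ρ k - 1) atTop (𝓝 κ) :=
      ((hsum.hasSum.tendsto_sum_nat.comp (tendsto_add_atTop_nat 1)).const_mul 2).sub_const 1
    obtain ⟨A, hA⟩ := (h1.eventually_const_lt (by nlinarith : (1 - e / 3) * κ < κ)).exists
    exact ⟨A, hA.le⟩
  have hε₂ : 0 < e * θ / (6 * (A + 1)) := by positivity
  obtain ⟨N, hN⟩ := eventually_atTop.1 (eventually_weight_sq_le hσ hratio hε₂)
  filter_upwards [exists_weights_almost_constant hσ hratio (by positivity : 0 < e / 3) (A + 1),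
    eventually_ge_atTop N] with l hl hNl m hlm hθm
  set T := scale σ m ^ 2 - scale σ l ^ 2
  have hT : T = ∑ i ∈ Finset.Ioc l m, σ i ^ 2 := scale_sq_sub σ hlm
  have hT0 : 0 ≤ T := by rw [hT]; exact Finset.sum_nonneg fun _ _ => sq_nonneg _
  set I := Finset.Ioc l m
  have hsplit := Finset.sum_filter_add_sum_filter_not I (fun i => l + A < i ∧ i + A ≤ m)
    (fun i => σ i ^ 2)
  rw [← hT] at hsplit
  -- At most `2 A` indices are near an end, each with a tiny share of `scale σ m ^ 2`, which is at
  -- most `T / θ`.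
  have hbd : ∑ i ∈ I with ¬ (l + A < i ∧ i + A ≤ m), σ i ^ 2 ≤ e / 3 * T := by
    have h1 : ∀ i ∈ I.filter fun i => ¬ (l + A < i ∧ i + A ≤ m),
        σ i ^ 2 ≤ e / (6 * (A + 1)) * T := by
      intro i hi
      have hi' := Finset.mem_Ioc.1 (Finset.mem_filter.1 hi).1
      have h2 := hN i (by omega)
      have h3 : scale σ i ^ 2 ≤ scale σ m ^ 2 :=
        pow_le_pow_left₀ (scale_nonneg _ _) (scale_mono σ hi'.2) 2
      calc σ i ^ 2 ≤ e * θ / (6 * (A + 1)) * scale σ m ^ 2 :=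
            h2.trans (mul_le_mul_of_nonneg_left h3 hε₂.le)
        _ = e / (6 * (A + 1)) * (θ * scale σ m ^ 2) := by ring
        _ ≤ _ := mul_le_mul_of_nonneg_left hθm (by positivity)
    have hcard : (I.filter fun i => ¬ (l + A < i ∧ i + A ≤ m)).card ≤ 2 * A := by
      have hsub : (I.filter fun i => ¬ (l + A < i ∧ i + A ≤ m)) ⊆
          Finset.Ioc l (l + A) ∪ Finset.Ioc (m - A) m := by
        intro i hi
        simp only [I, Finset.mem_filter, Finset.mem_Ioc, Finset.mem_union] at hi ⊢
        omega
      refine (Finset.card_le_card hsub).trans ((Finset.card_union_le _ _).trans ?_)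
      simp only [Nat.card_Ioc]; omega
    refine (Finset.sum_le_card_nsmul _ _ _ h1).trans ?_
    rw [nsmul_eq_mul]
    have hcard' : ((I.filter fun i => ¬ (l + A < i ∧ i + A ≤ m)).card : ℝ) ≤ 2 * (A + 1) := by
      have : ((I.filter fun i => ¬ (l + A < i ∧ i + A ≤ m)).card : ℝ) ≤ 2 * A := by
        exact_mod_cast hcard
      linarith
    calc _ ≤ 2 * ((A : ℝ) + 1) * (e / (6 * (A + 1)) * T) :=
          mul_le_mul_of_nonneg_right hcard' (by positivity)
      _ = e / 3 * T := by field_simp; ring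
  have hrow : ∑ i ∈ I with (l + A < i ∧ i + A ≤ m),
      (1 - e / 3) * (2 * ∑ k ∈ Finset.range (A + 1), ρ k - 1) * σ i ^ 2 ≤ blockCov ρ σ I I := by
    refine le_trans (Finset.sum_le_sum fun i hi => ?_) (Finset.sum_le_sum_of_subset_of_nonneg
      (Finset.filter_subset _ I) fun i hi _ => Finset.sum_nonneg fun j hj => ?_)
    · have hi' := (Finset.mem_filter.1 hi).2
      exact le_sum_corr_row hρ hρ0 hσ hl hi'.1 hi'.2
    · exact mul_nonneg (mul_nonneg (hσ i (by have := (Finset.mem_Ioc.1 hi).1; omega)).le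
        (hσ j (by have := (Finset.mem_Ioc.1 hj).1; omega)).le) (hρ _)
  rw [← Finset.mul_sum] at hrow
  have hin : (1 - e / 3) * T ≤ ∑ i ∈ I with (l + A < i ∧ i + A ≤ m), σ i ^ 2 := by linarith
  refine le_trans ?_ hrow
  have h0 : 0 ≤ 1 - e / 3 := by linarith
  -- One factor each for truncating the lags, for varying weights and for the ends of the block.
  calc (1 - e) * (κ * T) ≤ (1 - e / 3) ^ 3 * (κ * T) := by
        refine mul_le_mul_of_nonneg_right ?_ (by positivity)
        nlinarith [mul_nonneg he.le (sub_nonneg.2 he1), sq_nonneg e, pow_pos he 3]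
    _ = (1 - e / 3) * ((1 - e / 3) * κ) * ((1 - e / 3) * T) := by ring
    _ ≤ _ := mul_le_mul (mul_le_mul_of_nonneg_left hA h0) hin (by positivity)
        (mul_nonneg h0 (le_trans (by positivity) hA))

end Covariance
end WeightedPersistence

namespace WeightedPersistence
open scoped ENNReal NNReal

/-! ### Geometric sample points. -/

section SamplePoints

variable {ρ σ : ℕ → ℝ}

lemma scale_pos (hσ : ∀ i, 1 ≤ i → 0 < σ i) {n : ℕ} (hn : 1 ≤ n) : 0 < scale σ n :=
  Real.sqrt_pos.2 (Finset.sum_pos (fun i hi => pow_pos (hσ i (Finset.mem_Icc.1 hi).1) 2)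
    ⟨1, Finset.mem_Icc.2 ⟨le_rfl, hn⟩⟩)

/-- Take the first index reaching growth `1 + η / 2`: a single weight is too small to overshoot `1 +
η`. -/
lemma eventually_exists_next (hσ : ∀ i, 1 ≤ i → 0 < σ i) (hs : Tendsto (scale σ) atTop atTop)
    (hratio : ∀ l : ℕ, 1 ≤ l → Tendsto (fun n => σ (n + l) / σ n) atTop (𝓝 1))
    {η : ℝ} (hη : 0 < η) (hη1 : η ≤ 1) :
    ∀ᶠ m in atTop, ∃ m' > m, (1 + η / 2) * scale σ m ^ 2 ≤ scale σ m' ^ 2 ∧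
      scale σ m' ^ 2 ≤ (1 + η) * scale σ m ^ 2 := by
  obtain ⟨N, hN⟩ := eventually_atTop.1
    (eventually_weight_sq_le hσ hratio (by positivity : 0 < η / 8))
  filter_upwards [eventually_ge_atTop (N + 1)] with m hm
  have hpos := pow_pos (scale_pos hσ (by omega : 1 ≤ m)) 2
  have hex : ∃ n, (1 + η / 2) * scale σ m ^ 2 ≤ scale σ n ^ 2 :=
    (((tendsto_pow_atTop two_ne_zero).comp hs).eventually_ge_atTop _).exists
  classical
  set m' := Nat.find hex
  have h1 : (1 + η / 2) * scale σ m ^ 2 ≤ scale σ m' ^ 2 := Nat.find_spec hex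
  have hlt : m < m' := by
    by_contra h
    have : scale σ m' ^ 2 ≤ scale σ m ^ 2 :=
      pow_le_pow_left₀ (scale_nonneg _ _) (scale_mono σ (not_lt.1 h)) 2
    nlinarith
  have h2 : scale σ (m' - 1) ^ 2 < (1 + η / 2) * scale σ m ^ 2 :=
    not_le.1 (Nat.find_min hex (m := m' - 1) (by omega))
  have h3 := scale_sq_sub σ (Nat.sub_le m' 1)
  have h4 : Finset.Ioc (m' - 1) m' = {m'} := by ext; simp; omega
  rw [h4, Finset.sum_singleton] at h3
  have h5 := hN m' (by omega)
  refine ⟨m', hlt, h1, ?_⟩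
  have h6 : (1 - η / 8) * scale σ m' ^ 2 ≤ (1 + η / 2) * scale σ m ^ 2 := by linarith
  have h7 : (1 + η / 2) * scale σ m ^ 2 ≤ (1 - η / 8) * ((1 + η) * scale σ m ^ 2) := by
    have : 0 ≤ η * (1 - η) := mul_nonneg hη.le (by linarith)
    nlinarith
  exact le_of_mul_le_mul_left (h6.trans h7) (by linarith)

/-- Sample points along which the squared scale grows by factors between `1 + η / 2` and `1 + η`,
and between which the block variances are nearly proportional to the squared weights. -/
lemma exists_sample_points (hρ : ∀ i, 0 ≤ ρ i) (hsum : Summable ρ) (hρ0 : ρ 0 = 1)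
    (hσ : ∀ i, 1 ≤ i → 0 < σ i) (hs : Tendsto (scale σ) atTop atTop)
    (hratio : ∀ l : ℕ, 1 ≤ l → Tendsto (fun n => σ (n + l) / σ n) atTop (𝓝 1))
    {e η : ℝ} (he : 0 < e) (he1 : e ≤ 1) (hη : 0 < η) (hη1 : η ≤ 1) :
    ∃ t : ℕ → ℕ, t 0 = 0 ∧ StrictMono t ∧ 1 ≤ scale σ (t 1) ∧
      (∀ k, (1 + η / 2) * scale σ (t (k + 1)) ^ 2 ≤ scale σ (t (k + 2)) ^ 2) ∧
      (∀ k, scale σ (t (k + 2)) ^ 2 ≤ (1 + η) * scale σ (t (k + 1)) ^ 2) ∧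
      ∀ k, (1 - e) * (totalCorr ρ * (scale σ (t (k + 1)) ^ 2 - scale σ (t k) ^ 2)) ≤
        blockCov ρ σ (Finset.Ioc (t k) (t (k + 1))) (Finset.Ioc (t k) (t (k + 1))) := by
  have hκ := one_le_totalCorr hρ hsum hρ0
  -- Growth by `1 + η / 2` or more, but at most by `2`, gives a block at least `η / 4` of the final
  -- squared scale.
  have hblock := eventually_le_blockCov hρ hsum hρ0 hσ hratio (e := e / 2) (θ := η / 4)
    (by positivity) (by linarith) (by positivity)
  obtain ⟨L, hL⟩ := eventually_atTop.1
    (hblock.and (eventually_exists_next hσ hs hratio hη hη1))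
  choose f hf using fun m (hm : L ≤ m) => (hL m hm).2
  -- The default value is irrelevant, since the orbit starts beyond `L` and increases.
  set g : ℕ → ℕ := fun m => if hm : L ≤ m then f m hm else m
  have hg : ∀ m, L ≤ m → m < g m ∧ (1 + η / 2) * scale σ m ^ 2 ≤ scale σ (g m) ^ 2 ∧
      scale σ (g m) ^ 2 ≤ (1 + η) * scale σ m ^ 2 := fun m hm => by
    simp only [g, dif_pos hm]; exact hf m hm
  -- The first block starts at zero, where the asymptotics say nothing. `M` is so large that the
  -- indices up to `L` carry at most a proportion `e / 2` of its squared weight.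
  obtain ⟨M, hM1, hM2, hM3⟩ := ((((tendsto_pow_atTop two_ne_zero).comp hs).eventually_ge_atTop
    (2 / e * scale σ L ^ 2)).and ((hs.eventually_ge_atTop 1).and (eventually_gt_atTop L))).exists
  simp only [Function.comp_apply] at hM1
  have hgL : ∀ k, L ≤ g^[k] M := fun k => by
    induction k with
    | zero => exact hM3.le
    | succ k ih =>
      rw [Function.iterate_succ_apply']; exact ih.trans (hg _ ih).1.le
  set t : ℕ → ℕ := fun k => Nat.casesOn k 0 fun k => g^[k] M
  have ht0 : t 0 = 0 := rfl
  have ht1 : ∀ k, t (k + 1) = g^[k] M := fun k => rfl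
  have ht2 : ∀ k, t (k + 2) = g (t (k + 1)) := fun k => by
    rw [ht1, ht1, Function.iterate_succ_apply']
  refine ⟨t, ht0, strictMono_nat_of_lt_succ fun k => ?_, hM2, fun k => ?_, fun k => ?_, fun k => ?_⟩
  · rcases k with _ | k
    · rw [ht0, ht1]; exact lt_of_le_of_lt (Nat.zero_le L) hM3
    · rw [ht2]; exact (hg _ (by rw [ht1]; exact hgL k)).1
  · rw [ht2]; exact (hg _ (by rw [ht1]; exact hgL k)).2.1
  · rw [ht2]; exact (hg _ (by rw [ht1]; exact hgL k)).2.2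
  · rcases k with _ | k
    · have h0 : scale σ (t 0) ^ 2 = 0 := by rw [ht0, scale_sq]; simp
      have hM1' : scale σ L ^ 2 ≤ e / 2 * scale σ M ^ 2 := by
        have := mul_le_mul_of_nonneg_left hM1 (by positivity : 0 ≤ e / 2)
        refine le_trans (le_of_eq ?_) this
        field_simp
      have hsq := sq_nonneg (scale σ M)
      have h1 := (hL L le_rfl).1 M hM3.le (by nlinarith)
      have h2 : blockCov ρ σ (Finset.Ioc L M) (Finset.Ioc L M) ≤
          blockCov ρ σ (Finset.Ioc (t 0) (t (0 + 1))) (Finset.Ioc (t 0) (t (0 + 1))) :=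
        blockCov_mono hρ hσ (Finset.Ioc_subset_Ioc_left (Nat.zero_le _))
          (Finset.Ioc_subset_Ioc_left (Nat.zero_le _))
          (fun i hi => by have := (Finset.mem_Ioc.1 hi).1; omega)
          (fun i hi => by have := (Finset.mem_Ioc.1 hi).1; omega)
      refine le_trans ?_ (h1.trans h2)
      rw [h0, sub_zero]
      change (1 - e) * (totalCorr ρ * scale σ M ^ 2) ≤ _
      have h3 : (1 - e / 2) * scale σ M ^ 2 ≤ scale σ M ^ 2 - scale σ L ^ 2 := by linarith
      calc _ ≤ (1 - e / 2) * (totalCorr ρ * ((1 - e / 2) * scale σ M ^ 2)) := by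
            have : 0 ≤ totalCorr ρ * scale σ M ^ 2 := by positivity
            nlinarith [mul_nonneg (sq_nonneg e) this]
        _ ≤ _ := by
            have : 0 ≤ 1 - e / 2 := by linarith
            gcongr
    · have hk : L ≤ t (k + 1) := by rw [ht1]; exact hgL k
      have hgk := hg _ hk
      rw [← ht2] at hgk
      have hsq := sq_nonneg (scale σ (t (k + 1)))
      have h1 := (hL _ hk).1 (t (k + 2)) hgk.1.le (by nlinarith [hgk.2.1, hgk.2.2])
      refine le_trans ?_ h1
      have : 0 ≤ totalCorr ρ * (scale σ (t (k + 2)) ^ 2 - scale σ (t (k + 1)) ^ 2) :=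
        mul_nonneg (by linarith) (by nlinarith [hgk.2.1])
      exact mul_le_mul_of_nonneg_right (by linarith) this

end SamplePoints

/-! ### Comparison from above with an independent walk. -/

section Comparison

variable {Ω : Type*} [MeasurableSpace Ω] {P : Measure Ω} {ξ : ℕ → Ω → ℝ} {σ : ℕ → ℝ}

lemma sum_range_sum_Ioc {t : ℕ → ℕ} (ht : Monotone t) (f : ℕ → ℝ) (n : ℕ) :
    ∑ k ∈ Finset.range n, ∑ i ∈ Finset.Ioc (t k) (t (k + 1)), f i =
      ∑ i ∈ Finset.Ioc (t 0) (t n), f i := by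
  induction n with
  | zero => simp
  | succ n ih =>
    rw [Finset.sum_range_succ, ih, Finset.sum_Ioc_consecutive _ (ht (Nat.zero_le n))
      (ht (Nat.le_succ n))]

/-- Schur's test on pairs (block, index): the blocks tile an interval, so row sums are again at most
`totalCorr ρ`. -/
lemma sum_sum_blockCov_le {ρ : ℕ → ℝ} (hρ : ∀ i, 0 ≤ ρ i) (hsum : Summable ρ) (hρ0 : ρ 0 = 1)
    {t : ℕ → ℕ} (ht : Monotone t) (n : ℕ) (x : Fin n → ℝ) :
    ∑ k, ∑ l, x k * x l * blockCov ρ σ (Finset.Ioc (t k) (t (k + 1)))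
        (Finset.Ioc (t l) (t (l + 1))) ≤
      totalCorr ρ * ∑ k, x k ^ 2 * ∑ i ∈ Finset.Ioc (t k) (t (k + 1)), σ i ^ 2 := by
  set D : Finset ((_ : Fin n) × ℕ) :=
    Finset.univ.sigma fun k : Fin n => Finset.Ioc (t k) (t (k + 1))
  have h := sum_sum_mul_le_of_row_le D (r := fun p q => ρ ((p.2 - q.2) + (q.2 - p.2)))
    (K := totalCorr ρ) (fun p q => by rw [add_comm]) (fun p q => hρ _) (fun p _ => ?_)
    (fun p => x p.1 * σ p.2)
  · simp only [D, Finset.sum_sigma] at h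
    refine le_trans (le_of_eq ?_) (h.trans_eq ?_)
    · refine Finset.sum_congr rfl fun k _ => ?_
      rw [Finset.sum_comm]
      refine Finset.sum_congr rfl fun l _ => ?_
      rw [blockCov, Finset.mul_sum]
      refine Finset.sum_congr rfl fun i _ => ?_
      rw [Finset.mul_sum]
      exact Finset.sum_congr rfl fun j _ => by ring
    · congr 1
      refine Finset.sum_congr rfl fun k _ => ?_
      rw [Finset.mul_sum]
      exact Finset.sum_congr rfl fun j _ => by ring
  · simp only [D, Finset.sum_sigma]
    rw [Fin.sum_univ_eq_sum_range fun k => ∑ i ∈ Finset.Ioc (t k) (t (k + 1)),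
      ρ ((p.2 - i) + (i - p.2)), sum_range_sum_Ioc ht]
    exact sum_corr_row_le hρ hsum hρ0 _ _

/-- The persistence probability of the weighted sums is dominated by that of a walk with
independent increments observed at sample points. -/
lemma persistenceProb_le_walkNeg (hgauss : IsGaussianProcess ξ P)
    (hcentered : ∀ i, ∫ ω, ξ i ω ∂P = 0) (hstat : IsStationary ξ P)
    (hρ : ∀ i, 0 ≤ corr ξ P i) (hsum : Summable (corr ξ P)) (hρ0 : corr ξ P 0 = 1)
    (hσ : ∀ i, 1 ≤ i → 0 < σ i) {t : ℕ → ℕ} (ht0 : t 0 = 0) (ht : StrictMono t) {e : ℝ}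
    (he : e < 1 / 2)
    (hblock : ∀ k, (1 - e) * (totalCorr (corr ξ P) *
      (scale σ (t (k + 1)) ^ 2 - scale σ (t k) ^ 2)) ≤
        blockCov (corr ξ P) σ (Finset.Ioc (t k) (t (k + 1))) (Finset.Ioc (t k) (t (k + 1))))
    {c : ℕ → ℝ} (hc : ∀ k, 0 < c k)
    (hc2 : ∀ k, c k ^ 2 = scale σ (t (k + 1)) ^ 2 - scale σ (t k) ^ 2)
    {N n : ℕ} (hN : t N ≤ n) :
    persistenceProb σ ξ P n ≤ (√(1 - 2 * e))⁻¹ ^ N * stdSeq.real (walkNeg c N) := by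
  have := hgauss.isProbabilityMeasure
  have hκ := one_le_totalCorr hρ hsum hρ0
  set ρ := corr ξ P
  set κ := totalCorr ρ
  have hκ0 : 0 < κ := by linarith
  have hsκ : 0 < √κ := Real.sqrt_pos.2 hκ0
  have hsκ2 : √κ * √κ = κ := Real.mul_self_sqrt hκ0.le
  set B : ℕ → Finset ℕ := fun k => Finset.Ioc (t k) (t (k + 1))
  have hB1 : ∀ k, ∀ i ∈ B k, 1 ≤ i := fun k i hi => by
    have := (Finset.mem_Ioc.1 hi).1; omega
  have hcB : ∀ k, c k ^ 2 = ∑ i ∈ B k, σ i ^ 2 := fun k => by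
    rw [hc2, scale_sq_sub σ (ht.monotone (Nat.le_succ k))]
  -- Normalising by the limiting deviation `√κ * c k` rather than the exact one gives `R ≤ 1`, at
  -- the price of a diagonal only close to `1`.
  set R : Matrix (Fin N) (Fin N) ℝ := fun k l => (√κ * c k)⁻¹ * (√κ * c l)⁻¹ * blockCov ρ σ (B k) (B l)
  set X : Ω → Fin N → ℝ := fun ω k => ∑ i ∈ B k, (√κ * c k)⁻¹ * σ i * ξ i ω
  have hlaw := map_sum_mul_eq_multivariateGaussian hgauss hcentered (fun k : Fin N => B k)
    (fun k i => (√κ * c k)⁻¹ * σ i) (R := R) fun k l => by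
      simp only [R, blockCov, integral_mul_eq_corr hstat, Finset.mul_sum]
      exact Finset.sum_congr rfl fun i _ => Finset.sum_congr rfl fun j _ => by ring
  obtain ⟨hRpsd, hmap⟩ := hlaw
  have hRsymm : ∀ k l, R k l = R l k := fun k l => by
    have := hRpsd.isHermitian.apply k l
    simpa using this.symm
  have hRnn : ∀ k l, 0 ≤ R k l := fun k l => by
    have h1 := hc k; have h2 := hc l
    refine mul_nonneg (by positivity) (Finset.sum_nonneg fun i hi => Finset.sum_nonneg fun j hj => ?_)
    exact mul_nonneg (mul_nonneg (hσ i (hB1 _ i hi)).le (hσ j (hB1 _ j hj)).le) (hρ _)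
  have hRdiag : ∀ k, 1 - e ≤ R k k := fun k => by
    have h1 := hblock k
    rw [← hc2] at h1
    have h2 : 0 < κ * c k ^ 2 := mul_pos hκ0 (pow_pos (hc k) 2)
    have h3 : R k k = blockCov ρ σ (B k) (B k) / (κ * c k ^ 2) := by
      simp only [R]
      rw [← mul_inv, mul_mul_mul_comm, hsκ2, ← sq, inv_mul_eq_div]
    rw [h3, le_div_iff₀ h2]
    exact h1
  have hRupp : ∀ x : Fin N → ℝ, ∑ k, ∑ l, x k * x l * R k l ≤ ∑ k, x k ^ 2 := fun x => by
    have h := sum_sum_blockCov_le (σ := σ) hρ hsum hρ0 ht.monotone N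
      fun k => x k * (√κ * c k)⁻¹
    refine le_trans (le_of_eq ?_) (h.trans_eq ?_)
    · exact Finset.sum_congr rfl fun i _ => Finset.sum_congr rfl fun j _ => by simp only [R, B]; ring
    · rw [Finset.mul_sum]
      refine Finset.sum_congr rfl fun k _ => ?_
      have hck := hc k
      change κ * ((x k * (√κ * c k)⁻¹) ^ 2 * ∑ i ∈ B k, σ i ^ 2) = _
      rw [← hcB, mul_pow, inv_pow, mul_pow, Real.sq_sqrt hκ0.le]
      field_simp
  have hlow := sub_smul_one_posSemidef hRsymm hRnn hRdiag hRupp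
  have hupp : ((1 : Matrix (Fin N) (Fin N) ℝ) - R).PosSemidef := by
    refine posSemidef_of_forall (fun k l => ?_) fun x => ?_
    · simp [Matrix.one_apply, hRsymm k l, eq_comm]
    · have h1 : ∑ k, ∑ l, x k * x l * ((1 : Matrix (Fin N) (Fin N) ℝ) - R) k l =
          ∑ k, x k ^ 2 - ∑ k, ∑ l, x k * x l * R k l := by
        rw [← Finset.sum_sub_distrib]
        refine Finset.sum_congr rfl fun k _ => ?_
        simp [Matrix.one_apply, mul_sub, Finset.sum_sub_distrib, sq]
      rw [h1]
      linarith [hRupp x]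
  -- Padding with zeros is harmless: the event depends on the first `N` coordinates only.
  set E : EuclideanSpace ℝ (Fin N) → ℕ → ℝ := fun y k => if h : k < N then y ⟨k, h⟩ else 0
  have hE : Measurable E := by
    rw [measurable_pi_iff]
    intro k
    by_cases h : k < N
    · simp only [E, dif_pos h]; fun_prop
    · simp only [E, dif_neg h]; fun_prop
  have hA : MeasurableSet (E ⁻¹' walkNeg c N) := hE (measurableSet_walkNeg c N)
  have hwalk : ∀ (y : ℕ → ℝ) (l : ℕ), l ≤ N →
      walk c l (E (WithLp.toLp 2 fun k : Fin N => y k)) = walk c l y := fun y l hl => by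
    refine Finset.sum_congr rfl fun k hk => ?_
    have : k < N := (Finset.mem_range.1 hk).trans_le hl
    simp [E, this]
  have hmem : ∀ y : ℕ → ℝ, E (WithLp.toLp 2 fun k : Fin N => y k) ∈ walkNeg c N ↔
      y ∈ walkNeg c N := fun y => by
    simp only [walkNeg, Set.mem_ofPred_eq]
    refine forall₂_congr fun l hl => ?_
    rw [hwalk y l (Finset.mem_Icc.1 hl).2]
  have hstd : stdGaussian (EuclideanSpace ℝ (Fin N)) (E ⁻¹' walkNeg c N) = stdSeq (walkNeg c N) := by
    rw [← map_stdSeq_eq_stdGaussian, Measure.map_apply (by fun_prop) hA]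
    congr 1
    ext y
    exact hmem y
  -- Constraints between sample times are dropped; at these times the walk built from `X` is `S /
  -- √κ`.
  have hsub : {ω | ∀ l ∈ Finset.Icc 1 n, partialSum σ ξ l ω < 0} ⊆
      (fun ω => WithLp.toLp 2 (X ω)) ⁻¹' (E ⁻¹' walkNeg c N) := by
    intro ω hω
    refine (hmem fun k => ∑ i ∈ B k, (√κ * c k)⁻¹ * σ i * ξ i ω).2 fun l hl => ?_
    rw [Finset.mem_Icc] at hl
    have htl : 1 ≤ t l := by have := ht (by omega : 0 < l); omega
    have h1 := hω (t l) (Finset.mem_Icc.2 ⟨htl, (ht.monotone hl.2).trans hN⟩)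
    have h2 : walk c l (fun k => ∑ i ∈ B k, (√κ * c k)⁻¹ * σ i * ξ i ω) =
        (√κ)⁻¹ * partialSum σ ξ (t l) ω := by
      have h3 : Finset.Icc 1 (t l) = Finset.Ioc (t 0) (t l) := by rw [ht0]; ext; simp; omega
      rw [walk, partialSum, h3, ← sum_range_sum_Ioc ht.monotone, Finset.mul_sum]
      refine Finset.sum_congr rfl fun k _ => ?_
      rw [Finset.mul_sum, Finset.mul_sum]
      refine Finset.sum_congr rfl fun i _ => ?_
      have := (hc k).ne'
      field_simp
    rw [h2]
    exact mul_neg_of_pos_of_neg (inv_pos.2 hsκ) h1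
  have hXae : AEMeasurable (fun ω => WithLp.toLp 2 (X ω)) P :=
    ((hasGaussianLaw_sum_mul hgauss (fun k : Fin N => B k)
      fun k i => (√κ * c k)⁻¹ * σ i).toLp_pi 2).aemeasurable
  have hle : P {ω | ∀ l ∈ Finset.Icc 1 n, partialSum σ ξ l ω < 0} ≤
      ENNReal.ofReal (√(1 - 2 * e))⁻¹ ^ N * stdSeq (walkNeg c N) := by
    refine (measure_mono hsub).trans ?_
    rw [← Measure.map_apply_of_aemeasurable hXae hA, hmap, ← hstd]
    have := multivariateGaussian_apply_le hRpsd (by linarith : 0 < 1 - 2 * e) hlow hupp hA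
    rwa [Fintype.card_fin] at this
  have h := ENNReal.toReal_mono (ENNReal.mul_ne_top (ENNReal.pow_ne_top ENNReal.ofReal_ne_top)
    (measure_ne_top _ _)) hle
  rw [ENNReal.toReal_mul, ENNReal.toReal_pow, ENNReal.toReal_ofReal (by positivity)] at h
  exact h

end Comparison
end WeightedPersistence

namespace WeightedPersistence
open scoped ENNReal NNReal

/-! ### Polynomial bounds in the scale. -/

section Bounds

variable {Ω : Type*} [MeasurableSpace Ω] {P : Measure Ω}
  {ξ : ℕ → Ω → ℝ} {σ : ℕ → ℝ}

lemma gaussianReal_real_pos {s : Set ℝ} (hs : IsOpen s) (hne : s.Nonempty) :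
    0 < (gaussianReal 0 1).real s := by
  rw [measureReal_def, ENNReal.toReal_pos_iff]
  refine ⟨?_, measure_lt_top _ _⟩
  rw [pos_iff_ne_zero]
  intro h
  have := gaussianReal_absolutelyContinuous' 0 (one_ne_zero : (1 : ℝ≥0) ≠ 0) h
  exact (hs.measure_pos volume hne).ne' this

/-- The persistence probability is at least of order `1 / s(n)`. -/
lemma exists_div_scale_le_persistenceProb (hgauss : IsGaussianProcess ξ P)
    (hcentered : ∀ i, ∫ ω, ξ i ω ∂P = 0) (hstat : IsStationary ξ P)
    (hρ : ∀ i, 0 ≤ corr ξ P i) (hsum : Summable (corr ξ P)) (hρ0 : corr ξ P 0 = 1)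
    (hσ : ∀ i, 1 ≤ i → 0 < σ i) (hs : Tendsto (scale σ) atTop atTop) :
    ∃ K > 0, ∀ᶠ n in atTop, K / scale σ n ≤ persistenceProb σ ξ P n := by
  set v : ℕ → ℝ := fun k =>
    blockCov (corr ξ P) σ (Finset.Icc 1 k) (Finset.Icc 1 k) with hv
  have hinc : ∀ k, σ (k + 1) ^ 2 ≤ v (k + 1) - v k := blockCov_succ_sub hρ hρ0 hσ
  have hincpos : ∀ k, 0 < v (k + 1) - v k := fun k =>
    (pow_pos (hσ (k + 1) (by omega)) 2).trans_le (hinc k)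
  set c : ℕ → ℝ := fun k => √(v (k + 1) - v k) with hc
  have hc2 : ∀ k, c k ^ 2 = v (k + 1) - v k := fun k => Real.sq_sqrt (hincpos k).le
  have hc0 : 0 < c 0 := Real.sqrt_pos.2 (hincpos 0)
  set κ := totalCorr (corr ξ P)
  have hκ : 1 ≤ κ := one_le_totalCorr hρ hsum hρ0
  set γ := (gaussianReal 0 1).real (Set.Iio (-1)) with hγ
  have hγ0 : 0 < γ := gaussianReal_real_pos isOpen_Iio ⟨-2, by norm_num⟩
  set A := 2 * Real.exp (-(1 / 2)) / √(2 * Real.pi)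
  have hA : 0 < A := by positivity
  refine ⟨γ * (A * (c 0 / √κ)), by positivity, ?_⟩
  have hs2 : Tendsto (fun n => scale σ n ^ 2) atTop atTop :=
    (tendsto_pow_atTop two_ne_zero).comp hs
  -- The threshold makes the variance after the first step at least `c 0 ^ 2`, as `le_oddMass`
  -- requires.
  filter_upwards [hs2.eventually_ge_atTop (σ 1 ^ 2 + c 0 ^ 2), eventually_ge_atTop 2] with n hn hn2
  obtain ⟨m, rfl⟩ : ∃ m, n = m + 1 := ⟨n - 1, by omega⟩
  have hspos : 0 < scale σ (m + 1) := scale_pos hσ (by omega)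
  have hVsum : ∑ i ∈ Finset.range m, c (i + 1) ^ 2 = v (m + 1) - v 1 := by
    simp_rw [hc2]
    exact Finset.sum_range_sub (fun i => v (i + 1)) m
  have hv1 : 0 ≤ v 1 := by
    have h0 : v 0 = 0 := by simp [hv, blockCov]
    have := hincpos 0
    rw [h0] at this
    simpa using this.le
  have hVle : v (m + 1) - v 1 ≤ κ * scale σ (m + 1) ^ 2 := by
    have := blockCov_self_le (σ := σ) hρ hsum hρ0 (Finset.Icc 1 (m + 1))
    rw [← scale_sq] at this
    linarith
  have hVge : scale σ (m + 1) ^ 2 - σ 1 ^ 2 ≤ v (m + 1) - v 1 := by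
    rw [scale_sq, ← Finset.sum_range_sub (fun i => v (i + 1)) m]
    have h2 : ∑ i ∈ Finset.Icc 1 (m + 1), σ i ^ 2 =
        ∑ i ∈ Finset.range m, σ (i + 1 + 1) ^ 2 + σ 1 ^ 2 := by
      rw [← Finset.sum_range_succ' (fun i => σ (i + 1) ^ 2), Finset.range_eq_Ico,
        Finset.sum_Ico_add' (fun i => σ i ^ 2)]
      rfl
    rw [h2, add_sub_cancel_right]
    exact Finset.sum_le_sum fun i _ => hinc (i + 1)
  set V : ℝ≥0 := (v (m + 1) - v 1).toNNReal
  have hVpos : 0 < v (m + 1) - v 1 := by nlinarith [pow_pos hc0 2]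
  have hV : (V : ℝ) = v (m + 1) - v 1 := Real.coe_toNNReal _ hVpos.le
  have hVne : V ≠ 0 := by
    intro h
    rw [h] at hV
    simp at hV
    linarith
  have h1 := le_walkNeg c hc0 m (hV.trans hVsum.symm)
  have h2 := le_oddMass hVne hc0.le (by rw [hV]; linarith)
  have h3 := stdSeq_walkNeg_le_persistenceProb hgauss hcentered hstat hρ hρ0 hσ hc2 (m + 1)
  have hodd : 0 ≤ oddMass V (c 0) := le_trans (by positivity) h2
  have h4 : γ * oddMass V (c 0) ≤ stdSeq.real (walkNeg c (m + 1)) := by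
    have := ENNReal.toReal_mono (measure_ne_top _ _) h1
    rwa [ENNReal.toReal_mul, ENNReal.toReal_ofReal hodd] at this
  have h5 : √(V : ℝ) ≤ √κ * scale σ (m + 1) := by
    rw [hV, Real.sqrt_le_left (by positivity), mul_pow, Real.sq_sqrt (by linarith)]
    exact hVle
  have hVs : 0 < √(V : ℝ) := Real.sqrt_pos.2 (by rw [hV]; exact hVpos)
  refine le_trans ?_ (h4.trans h3)
  calc γ * (A * (c 0 / √κ)) / scale σ (m + 1)
      = γ * (A * (c 0 / (√κ * scale σ (m + 1)))) := by field_simp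
    _ ≤ γ * (A * (c 0 / √V)) := by gcongr
    _ ≤ γ * oddMass V (c 0) := by gcongr

/-- The persistence probability is at most of order `s(n) ^ (-1 + 16 δ)` for every `δ > 0`. -/
lemma exists_persistenceProb_le (hgauss : IsGaussianProcess ξ P)
    (hcentered : ∀ i, ∫ ω, ξ i ω ∂P = 0) (hstat : IsStationary ξ P)
    (hρ : ∀ i, 0 ≤ corr ξ P i) (hsum : Summable (corr ξ P)) (hρ0 : corr ξ P 0 = 1)
    (hσ : ∀ i, 1 ≤ i → 0 < σ i) (hs : Tendsto (scale σ) atTop atTop)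
    (hratio : ∀ l : ℕ, 1 ≤ l → Tendsto (fun n => σ (n + l) / σ n) atTop (𝓝 1))
    {δ : ℝ} (hδ : 0 < δ) :
    ∃ C : ℝ, ∀ᶠ n in atTop,
      persistenceProb σ ξ P n ≤ Real.exp (C - (1 - 16 * δ) * Real.log (scale σ n)) := by
  set Q := (gaussianReal 0 1).real (Set.Ici (1 / δ)) with hQdef
  have hQ : 0 < Q := (gaussianReal_real_pos (isOpen_Ioi (a := 1 / δ)) ⟨1 / δ + 1, by simp⟩).trans_le
    (measureReal_mono Set.Ioi_subset_Ici_self)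
  set η := min 1 Q
  have hη : 0 < η := lt_min one_pos hQ
  have hη1 : η ≤ 1 := min_le_left _ _
  have hηQ : η ≤ Q := min_le_right _ _
  set b := 2 * √η
  have hb : 0 < b := by positivity
  have hbη : b ^ 2 = 4 * η := by rw [mul_pow, Real.sq_sqrt hη.le]; norm_num
  -- With this `e`, decoupling costs exactly `exp (δ η)` per block, matching the factor `1 + δ η` of
  -- the walk.
  set e := (1 - Real.exp (-(2 * (δ * η)))) / 2 with he_def
  have hexp1 : Real.exp (-(2 * (δ * η))) < 1 := by rw [Real.exp_lt_one_iff]; nlinarith [mul_pos hδ hη]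
  have he : 0 < e := by rw [he_def]; linarith
  have he2 : e < 1 / 2 := by rw [he_def]; linarith [Real.exp_pos (-(2 * (δ * η)))]
  have hsq : (√(1 - 2 * e))⁻¹ = Real.exp (δ * η) := by
    have h1 : 1 - 2 * e = Real.exp (-(δ * η)) ^ 2 := by
      rw [he_def, ← Real.exp_nat_mul]; push_cast; ring_nf
    rw [h1, Real.sqrt_sq (Real.exp_pos _).le, Real.exp_neg, inv_inv]
  obtain ⟨t, ht0, ht, ht1, hgrow, hstep, hblock⟩ :=
    exists_sample_points hρ hsum hρ0 hσ hs hratio he (by linarith) hη hη1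
  have hscale0 : scale σ 0 = 0 := by simp [scale]
  have htpos : ∀ k, 1 ≤ t (k + 1) := fun k => by have := ht.le_apply (x := k + 1); omega
  have hdiff : ∀ k, 0 < scale σ (t (k + 1)) ^ 2 - scale σ (t k) ^ 2 := by
    intro k
    rcases k with _ | k
    · rw [ht0, hscale0]
      nlinarith
    · have h1 := pow_pos (scale_pos hσ (htpos k)) 2
      have h2 := hgrow k
      nlinarith [mul_pos hη h1]
  set c : ℕ → ℝ := fun k => √(scale σ (t (k + 1)) ^ 2 - scale σ (t k) ^ 2) with hc_def
  have hc : ∀ k, 0 < c k := fun k => Real.sqrt_pos.2 (hdiff k)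
  have hc2 : ∀ k, c k ^ 2 = scale σ (t (k + 1)) ^ 2 - scale σ (t k) ^ 2 := fun k =>
    Real.sq_sqrt (hdiff k).le
  have hsd : ∀ k, walkSd c k = scale σ (t k) := by
    intro k
    rw [walkSd, ← Real.sqrt_sq (scale_nonneg σ (t k))]
    congr 1
    simp_rw [hc2]
    rw [Finset.sum_range_sub fun k => scale σ (t k) ^ 2, ht0, hscale0]
    ring
  have hcτ : ∀ k, 1 ≤ k → c k ^ 2 ≤ η * walkSd c k ^ 2 := by
    intro k hk
    obtain ⟨j, rfl⟩ : ∃ j, k = j + 1 := ⟨k - 1, by omega⟩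
    rw [hsd, hc2]
    linarith [hstep j]
  have hpow : ∀ N, (1 + η / 2) ^ N ≤ scale σ (t (N + 1)) ^ 2 := by
    intro N
    induction N with
    | zero => rw [pow_zero]; exact one_le_pow₀ ht1
    | succ N ih =>
      refine le_trans ?_ (hgrow N)
      rw [pow_succ, mul_comm]
      gcongr
  set K := (2 + b) * c 0 / b
  have hK : 0 < K := by have := hc 0; positivity
  refine ⟨δ * η + Real.log (2 * K), ?_⟩
  filter_upwards [eventually_ge_atTop (t 1)] with n hn
  -- `t (N + 1)` is the last sample point up to `n`, so its scale is within a factor `2` of `scale σ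
  -- n`.
  obtain ⟨N, hN1, hN2⟩ : ∃ N, t (N + 1) ≤ n ∧ n < t (N + 2) := by
    have hex : ∃ j, n < t (j + 2) := ⟨n, by have := ht.le_apply (x := n + 2); omega⟩
    classical
    refine ⟨Nat.find hex, ?_, Nat.find_spec hex⟩
    rcases hj : Nat.find hex with _ | j
    · exact hn
    · exact not_lt.1 (Nat.find_min hex (m := j) (by omega))
  have hs1 : 1 ≤ scale σ (t (N + 1)) :=
    ht1.trans (scale_mono σ (ht.monotone (by omega)))
  have hs2 : scale σ (t (N + 1)) ≤ scale σ n := scale_mono σ hN1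
  have hspos : 0 < scale σ n := by linarith
  have hs3 : scale σ n ≤ 2 * scale σ (t (N + 1)) := by
    refine (scale_mono σ hN2.le).trans (abs_le_of_sq_le_sq' ?_ (by linarith)).2
    nlinarith [hstep N]
  -- Geometric growth gives `N log (1 + η / 2) ≤ 2 log s(n)`, and `log (1 + η / 2) ≥ η / 4`.
  have hNη : N * η ≤ 8 * Real.log (scale σ n) := by
    have h1 := Real.log_le_log (by positivity) (hpow N)
    rw [Real.log_pow, Real.log_pow] at h1
    have h2 := Real.log_le_log (by linarith) hs2
    have h3 : η / 4 ≤ Real.log (1 + η / 2) := by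
      refine le_trans ?_ (Real.le_log_one_add_of_nonneg (by positivity))
      rw [le_div_iff₀ (by positivity)]
      nlinarith
    have h4 : (N : ℝ) * (η / 4) ≤ N * Real.log (1 + η / 2) := by gcongr
    push_cast at h1
    linarith
  have h1 := persistenceProb_le_walkNeg hgauss hcentered hstat hρ hsum hρ0 hσ ht0 ht he2 hblock
    hc hc2 hN1
  have h2 := walkNeg_real_le hc hδ hη hb hbη hcτ hηQ N
  rw [hsd] at h2
  rw [hsq] at h1
  calc persistenceProb σ ξ P n
      ≤ Real.exp (δ * η) ^ (N + 1) * ((1 + δ * η) ^ N * ((2 + b) * c 0) /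
          (b * scale σ (t (N + 1)))) := h1.trans (by gcongr)
    _ = Real.exp (δ * η) ^ (N + 1) * (1 + δ * η) ^ N * (K / scale σ (t (N + 1))) := by
        simp only [K]; field_simp
    _ ≤ Real.exp (δ * η) ^ (N + 1) * Real.exp (δ * η) ^ N * (2 * K / scale σ n) := by
        have : 0 < Real.exp (δ * η) := Real.exp_pos _
        gcongr ?_ * ?_ * ?_
        · gcongr; linarith [Real.add_one_le_exp (δ * η)]
        · rw [div_le_div_iff₀ (by linarith) hspos]
          nlinarith
    _ = Real.exp (δ * η + 2 * δ * (N * η) + Real.log (2 * K) - Real.log (scale σ n)) := by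
        rw [Real.exp_sub, Real.exp_add, Real.exp_log (by positivity), Real.exp_log hspos,
          ← Real.exp_nat_mul, ← Real.exp_nat_mul, ← Real.exp_add, ← mul_div_assoc]
        congr 3
        push_cast; ring
    _ ≤ _ := by
        rw [Real.exp_le_exp]
        nlinarith [mul_le_mul_of_nonneg_left hNη hδ.le]

end Bounds

end WeightedPersistence

/-! ### The logarithmic limit. -/

open WeightedPersistence in
theorem theorem1 {Ω : Type*} [MeasurableSpace Ω] (P : Measure Ω) [IsProbabilityMeasure P]
    (ξ : ℕ → Ω → ℝ)
    (hgauss : IsGaussianProcess ξ P)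
    (hcentered : ∀ i, ∫ ω, ξ i ω ∂P = 0)
    (hvar : ∀ i, ∫ ω, ξ i ω ^ 2 ∂P = 1)
    (hstat : WeightedPersistence.IsStationary ξ P)
    (hρ_nonneg : ∀ i, 0 ≤ WeightedPersistence.corr ξ P i)
    (hρ_summable : Summable (WeightedPersistence.corr ξ P))
    (σ : ℕ → ℝ)
    (hσ_pos : ∀ i, 1 ≤ i → 0 < σ i)
    (hs : Tendsto (WeightedPersistence.scale σ) atTop atTop)
    (hσ_ratio : ∀ l : ℕ, 1 ≤ l → Tendsto (fun n => σ (n + l) / σ n) atTop (𝓝 1))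
    (hσ_mono : ∃ C : ℝ, ∀ n m : ℕ, 1 ≤ n → n ≤ m →
      σ m / WeightedPersistence.scale σ m ≤ C * (σ n / WeightedPersistence.scale σ n)) :
    Tendsto (fun n => Real.log (WeightedPersistence.persistenceProb σ ξ P n) /
      Real.log (WeightedPersistence.scale σ n)) atTop (𝓝 (-1)) := by
  have hρ0 : corr ξ P 0 = 1 := by
    rw [corr, ← hvar 0]
    simp_rw [sq]
  have hlog : Tendsto (fun n => Real.log (scale σ n)) atTop atTop := Real.tendsto_log_atTop.comp hs
  obtain ⟨K, hK, hlow⟩ := exists_div_scale_le_persistenceProb hgauss hcentered hstat hρ_nonneg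
    hρ_summable hρ0 hσ_pos hs
  rw [tendsto_order]
  constructor
  · intro a ha
    filter_upwards [hlow, hs.eventually_gt_atTop 0, hlog.eventually_gt_atTop 0,
      hlog.eventually_gt_atTop (-Real.log K / (-1 - a))] with n h1 h2 h3 h4
    rw [lt_div_iff₀ h3]
    have h5 := Real.log_le_log (by positivity) h1
    rw [Real.log_div hK.ne' h2.ne'] at h5
    rw [div_lt_iff₀ (by linarith)] at h4
    linarith
  · intro a ha
    obtain ⟨C, hup⟩ := exists_persistenceProb_le hgauss hcentered hstat hρ_nonneg
      -- Then `16 δ` is half the gap `a + 1`; the other half absorbs the constant `C`.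
      hρ_summable hρ0 hσ_pos hs hσ_ratio (δ := (a + 1) / 32) (by linarith)
    filter_upwards [hlow, hup, hs.eventually_gt_atTop 0, hlog.eventually_gt_atTop 0,
      hlog.eventually_gt_atTop (C / ((a + 1) / 2))] with n h0 h1 h2 h3 h4
    rw [div_lt_iff₀ h3]
    have hpos : 0 < persistenceProb σ ξ P n := lt_of_lt_of_le (by positivity) h0
    have h5 := Real.log_le_log hpos h1
    rw [Real.log_exp] at h5
    rw [div_lt_iff₀ (by linarith)] at h4
    linarith
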